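/- Let $p$ be a prime, $m$ a natural number, and let $F_0$ be a field of characteristic $0$ or $\ge p$; if $\operatorname{char}(F_0)\neq p$, assume that $F_0$ contains a primitive $p$th root of unity $\rho$. Let $F$ be either the rational function field $F_0(\alpha_1,\beta_1,\dots,\alpha_m,\beta_m)$ in $2m$ independent variables or the iterated Laurent series field $F_0(\!(\alpha_1^{-1})\!)(\!(\beta_1^{-1})\!)\cdots(\!(\alpha_m^{-1})\!)(\!(\beta_m^{-1})\!)$. Let $A=A_1\otimes_F\cdots\otimes_F A_m$, where $$A_j=F\langle x,y : x^p=\alpha_j,\ y^p=\beta_j,\ yx=\rho xy\rangle \quad\text{if } \operatorname{char}(F_0)\neq p,$$ $$A_j=F\langle x,y : x^p-x=\alpha_j,\ y^p=\beta_j,\ yx=(x+1)y\rangle \quad\text{if } \operatorname{char}(F_0)=p.$$ Let $d=p^m$ be the degree of the central simple $F$-algebra $A$, and for $v\in A$ let $f_1(v),\dots,f_d(v)\in F$ be its characteristic coefficients, that is, the characteristic polynomial of the image of $v$ under an isomorphism $A\otimes_F \overline{F}\cong M_d(\overline{F})$ is $X^d+f_1(v)X^{d-1}+\cdots+f_d(v)$.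 Then every $F$-subspace $V$ of $A$ such that $f_i(v)=0$ for all $v\in V$ and all $1\le i\le p-1$ with $i\le d$ satisfies $\dim_F V\le \frac{p^{2m}-1}{p-1}$. -/

import Mathlib

open scoped TensorProduct

universe u

/-- A field extension of `F₀` together with two families of `m` elements (the slots). -/
structure SlotField (F₀ : Type u) [Field F₀] (m : ℕ) where
  carrier : Type u
  [field : Field carrier]
  [algebra : Algebra F₀ carrier]
  α : Fin m → carrier
  β : Fin m → carrier

namespace SlotField

attribute [instance] SlotField.field SlotField.algebra

instance (F₀ : Type u) [Field F₀] (m : ℕ) : CoeSort (SlotField F₀ m) (Type u) := ⟨carrier⟩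

/-- The rational function field `F₀(α₁, β₁, …, αₘ, βₘ)` in `2m` independent variables. -/
noncomputable def rational (F₀ : Type u) [Field F₀] (m : ℕ) : SlotField F₀ m where
  carrier := FractionRing (MvPolynomial (Fin m ⊕ Fin m) F₀)
  α i := algebraMap (MvPolynomial (Fin m ⊕ Fin m) F₀) _ (MvPolynomial.X (Sum.inl i))
  β i := algebraMap (MvPolynomial (Fin m ⊕ Fin m) F₀) _ (MvPolynomial.X (Sum.inr i))

/-- The iterated Laurent series field `F₀((α₁⁻¹))((β₁⁻¹))…((αₘ⁻¹))((βₘ⁻¹))`. At each step the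
uniformizers `single 1 1` of the two new Laurent series fields are `α⁻¹` and `β⁻¹`, so the new
slots are `α = single (-1) 1` (viewed as a constant in the outer field) and `β = single (-1) 1`. -/
noncomputable def laurent (F₀ : Type u) [Field F₀] : (m : ℕ) → SlotField F₀ m
  | 0 => { carrier := F₀, α := Fin.elim0, β := Fin.elim0 }
  | m + 1 =>
    let K := (laurent F₀ m).carrier
    { carrier := LaurentSeries (LaurentSeries K)
      α := Fin.snoc (α := fun _ => LaurentSeries (LaurentSeries K))
        (fun i => HahnSeries.C (HahnSeries.C ((laurent F₀ m).α i)))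
        (HahnSeries.C (HahnSeries.single (-1) 1))
      β := Fin.snoc (α := fun _ => LaurentSeries (LaurentSeries K))
        (fun i => HahnSeries.C (HahnSeries.C ((laurent F₀ m).β i)))
        (HahnSeries.single (-1) 1) }

end SlotField

section Symbol

variable {F : Type u} [Field F]

/-- The relations `x ^ p = α`, `y ^ p = β`, `y x = ρ x y` on the free algebra on `x` (index `0`)
and `y` (index `1`). -/
inductive SymbolRel (p : ℕ) (ρ α β : F) : FreeAlgebra F (Fin 2) → FreeAlgebra F (Fin 2) → Prop
  | x_pow : SymbolRel p ρ α β (FreeAlgebra.ι F 0 ^ p) (algebraMap F _ α)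
  | y_pow : SymbolRel p ρ α β (FreeAlgebra.ι F 1 ^ p) (algebraMap F _ β)
  | comm : SymbolRel p ρ α β (FreeAlgebra.ι F 1 * FreeAlgebra.ι F 0)
      (ρ • (FreeAlgebra.ι F 0 * FreeAlgebra.ι F 1))

/-- The symbol algebra `(α, β)_{p,F}` with respect to the primitive `p`-th root of unity `ρ`
(for fields of characteristic different from `p`, and `α`, `β` nonzero). -/
abbrev SymbolAlgebra (p : ℕ) (ρ α β : F) : Type u := RingQuot (SymbolRel p ρ α β)

/-- The relations `x ^ p - x = α`, `y ^ p = β`, `y x = (x + 1) y` on the free algebra on `x`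
(index `0`) and `y` (index `1`). -/
inductive SymbolRelCharP (p : ℕ) (α β : F) : FreeAlgebra F (Fin 2) → FreeAlgebra F (Fin 2) → Prop
  | x_pow : SymbolRelCharP p α β (FreeAlgebra.ι F 0 ^ p - FreeAlgebra.ι F 0) (algebraMap F _ α)
  | y_pow : SymbolRelCharP p α β (FreeAlgebra.ι F 1 ^ p) (algebraMap F _ β)
  | comm : SymbolRelCharP p α β (FreeAlgebra.ι F 1 * FreeAlgebra.ι F 0)
      ((FreeAlgebra.ι F 0 + 1) * FreeAlgebra.ι F 1)

/-- The symbol algebra `[α, β)_{p,F}` (for fields of characteristic `p`, and `β` nonzero). -/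
abbrev SymbolAlgebraCharP (p : ℕ) (α β : F) : Type u := RingQuot (SymbolRelCharP p α β)

end Symbol

section CharCoeff

variable (F : Type*) [Field F] {A : Type*} [Ring A] [Algebra F A]

/-- `c : F` is the coefficient of `X ^ (d - i)` in the characteristic polynomial of `a` computed
through an isomorphism of `K ⊗ A` with `M_d(K)`, where `K` is the algebraic closure of `F`. -/
def IsCharCoeff (i : ℕ) (a : A) (c : F) : Prop :=
  ∃ (d : ℕ) (φ : AlgebraicClosure F ⊗[F] A ≃ₐ[AlgebraicClosure F]
      Matrix (Fin d) (Fin d) (AlgebraicClosure F)),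
    i ≤ d ∧ (φ (1 ⊗ₜ[F] a)).charpoly.coeff (d - i) = algebraMap F (AlgebraicClosure F) c

open Classical in
/-- The `i`-th characteristic coefficient `f_i : A → F` of a central simple `F`-algebra `A` of
degree `d`, for `i ≤ d`: the reduced characteristic polynomial of `a` is
`X ^ d + f_1(a) X ^ (d - 1) + ⋯ + f_d(a)`. (The value is `0` where this is undefined.) -/
noncomputable def charCoeff (i : ℕ) (a : A) : F :=
  if h : ∃ c : F, IsCharCoeff F i a c then h.choose else 0

end CharCoeff

/-!
Over `K`, an algebraic closure of `F`, the algebra `A` becomes a matrix algebra in which the basis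
of monomials in the generators, indexed by `(ℤ/p)^(2m)`, acts by monomial matrices. A valuation of
`F` at which the values of the slots are independent modulo `p` extends to `K`, and the leading
terms of the basis elements then have pairwise distinct values, even up to scalars from `F`. So
every nonzero `z` in `A` has a leading index in `(ℤ/p)^(2m)`, and `dim V` is at most the number of
leading indices of elements of `V`.

By Newton's identities, `f_1 = ⋯ = f_(p-1) = 0` on `V` forces `tr(v ^ (p - 1)) = 0` for `v` in
`V`. The trace is a nonzero multiple of one coordinate, with index `t` say: `t = 0` in the Kummer
case, while in characteristic `p` the index has the exponents `-1` in the `x`-directions.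
Polarizing, the coordinate `t` also vanishes on the sum of all products of `i` factors `v` and `j`
factors `v'` with `i + j = p - 1`. If the leading matrices of `v` and `v'` commute, that sum has
leading index `i u + j u'`, since `p - 1 choose j` does not vanish in the residue field. Hence
`i u + j u' ≠ t` for all leading indices `u`, `u'` on `V` with `u' + t` proportional to `u + t`, and
therefore `u ↦ u + t` maps the leading indices injectively to the points of the projective space
of `(ℤ/p)^(2m)`, of which there are `(p^(2m) - 1) / (p - 1)`.
-/

section NewtonIdentities

open Matrix Polynomial

variable {n R : Type*} [Fintype n] [DecidableEq n] [CommRing R]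

theorem derivative_det (N : Matrix n n R[X]) :
    derivative N.det = (N.map derivative * N.adjugate).trace := by
  have hrow (i : n) : (N.map derivative * N.adjugate) i i =
      ∑ σ : Equiv.Perm n, Equiv.Perm.sign σ •
        ((∏ j ∈ Finset.univ.erase i, N j (σ j)) * derivative (N i (σ i))) := by
    have hcramer : (N.map derivative * N.adjugate) i i =
        (N.updateRow i (N.map derivative i)).det := by
      rw [← cramer_transpose_apply, cramer_eq_adjugate_mulVec, ← adjugate_transpose,
        mulVec_transpose]
      rfl
    rw [hcramer, ← det_transpose, det_apply]
    refine Finset.sum_congr rfl fun σ _ => ?_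
    rw [← Finset.prod_erase_mul _ _ (Finset.mem_univ i)]
    congr 2
    · refine Finset.prod_congr rfl fun j hj => ?_
      rw [transpose_apply, updateRow_ne (Finset.ne_of_mem_erase hj)]
    · rw [transpose_apply, updateRow_self, map_apply]
  rw [← det_transpose, det_apply, derivative_sum, trace]
  simp only [diag_apply, hrow, transpose_apply]
  rw [Finset.sum_comm]
  refine Finset.sum_congr rfl fun σ _ => ?_
  rw [Units.smul_def, derivative_smul, derivative_prod_finset, ← Finset.smul_sum,
    Units.smul_def]

/-- The coefficients of the adjugate of `1 - X • M`, as matrices over `R`. -/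
noncomputable def adjugateCoeff (M : Matrix n n R) (k : ℕ) : Matrix n n R :=
  (matPolyEquiv (1 - (X : R[X]) • M.map C).adjugate).coeff k

theorem coeff_derivative_charpolyRev (M : Matrix n n R) (k : ℕ) :
    (derivative M.charpolyRev).coeff k = -(M * adjugateCoeff M k).trace := by
  have hderiv : (1 - (X : R[X]) • M.map C).map derivative = -M.map C := by
    ext1 i j
    simp [one_apply, apply_ite derivative]
  rw [charpolyRev, derivative_det, hderiv, neg_mul, trace_neg, coeff_neg, adjugateCoeff,
    ← coeff_C_mul, ← matPolyEquiv_map_C, ← map_mul, trace, trace, finsetSum_coeff]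
  simp only [diag_apply, matPolyEquiv_coeff_apply]

theorem adjugateCoeff_eq_sum (M : Matrix n n R) (k : ℕ) :
    adjugateCoeff M k = ∑ i ∈ Finset.range (k + 1), M.charpolyRev.coeff i • M ^ (k - i) := by
  have hadj : matPolyEquiv (1 - (X : R[X]) • M.map C).adjugate * (1 - C M * X) =
      M.charpolyRev.map (algebraMap R (Matrix n n R)) := by
    have h := congrArg matPolyEquiv (adjugate_mul (1 - (X : R[X]) • M.map C))
    rwa [map_mul, map_sub, map_one, matPolyEquiv_map_smul, matPolyEquiv_map_C, map_X,
      X_mul_C, matPolyEquiv_smul_one] at h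
  have hcoeff (k : ℕ) := congrArg (coeff · k) hadj
  simp only [mul_sub, mul_one, ← mul_assoc, coeff_sub, coeff_map] at hcoeff
  induction k with
  | zero =>
    have h := hcoeff 0
    rw [coeff_mul_X_zero, sub_zero] at h
    simp [adjugateCoeff, h, Algebra.algebraMap_eq_smul_one]
  | succ k ih =>
    have h := hcoeff (k + 1)
    rw [coeff_mul_X, coeff_mul_C, sub_eq_iff_eq_add'] at h
    rw [Finset.sum_range_succ, Nat.sub_self, pow_zero, ← Algebra.algebraMap_eq_smul_one,
      adjugateCoeff, h, ← adjugateCoeff, ih, Finset.sum_mul]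
    congr 1
    refine Finset.sum_congr rfl fun i hi => ?_
    rw [smul_mul_assoc, ← pow_succ, Nat.sub_add_comm (Finset.mem_range_succ_iff.1 hi)]

/-- Newton's identities, from Jacobi's formula `derivative_det` for `1 - X • M`. -/
theorem natCast_mul_coeff_charpolyRev (M : Matrix n n R) (k : ℕ) :
    (k : R) * M.charpolyRev.coeff k =
      -∑ i ∈ Finset.range k, M.charpolyRev.coeff i * (M ^ (k - i)).trace := by
  rcases k with _ | k
  · simp
  rw [mul_comm, Nat.cast_succ, ← coeff_derivative, coeff_derivative_charpolyRev,
    adjugateCoeff_eq_sum, Finset.mul_sum, trace_sum]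
  congr 1
  refine Finset.sum_congr rfl fun i hi => ?_
  rw [mul_smul_comm, trace_smul, smul_eq_mul, ← pow_succ',
    Nat.sub_add_comm (Finset.mem_range_succ_iff.1 hi)]

theorem coeff_charpolyRev_mem_range (M : Matrix n n R) {F : Type*} [Field F] [Algebra F R] {N : ℕ}
    (htrace : ∀ k, (M ^ k).trace ∈ (algebraMap F R).range)
    (hN : ∀ k : ℕ, 0 < k → k ≤ N → (k : F) ≠ 0) :
    ∀ k ≤ N, M.charpolyRev.coeff k ∈ (algebraMap F R).range := by
  intro k
  induction k using Nat.strong_induction_on with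
  | _ k ih =>
    intro hk
    rcases k.eq_zero_or_pos with rfl | hpos
    · rw [coeff_zero_eq_eval_zero, eval_charpolyRev]
      exact one_mem _
    · have hmem : (k : R) * M.charpolyRev.coeff k ∈ (algebraMap F R).range := by
        rw [natCast_mul_coeff_charpolyRev]
        refine neg_mem (sum_mem fun i hi => mul_mem (ih i ?_ ?_) (htrace _)) <;>
          have := Finset.mem_range.1 hi <;> omega
      have hcancel : M.charpolyRev.coeff k =
          algebraMap F R (k : F)⁻¹ * ((k : R) * M.charpolyRev.coeff k) := by
        rw [← mul_assoc, ← map_natCast (algebraMap F R), ← map_mul,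
          inv_mul_cancel₀ (hN k hpos hk), map_one, one_mul]
      rw [hcancel]
      exact mul_mem ⟨_, rfl⟩ hmem

theorem trace_pow_eq_zero_of_coeff_charpolyRev (M : Matrix n n R) {N : ℕ} (hN : N ≠ 0)
    (hM : ∀ k, 0 < k → k ≤ N → M.charpolyRev.coeff k = 0) : (M ^ N).trace = 0 := by
  have hnewton := natCast_mul_coeff_charpolyRev M N
  rw [hM N (Nat.pos_of_ne_zero hN) le_rfl, mul_zero, eq_comm, neg_eq_zero,
    Finset.sum_eq_single 0] at hnewton
  · rwa [coeff_zero_eq_eval_zero, eval_charpolyRev, one_mul] at hnewton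
  · intro k hk hk0
    rw [hM k (Nat.pos_of_ne_zero hk0) (Finset.mem_range.1 hk).le, zero_mul]
  · simp [hN]

theorem coeff_charpolyRev_of_le (M : Matrix n n R) [Nontrivial R] {k : ℕ}
    (hk : k ≤ Fintype.card n) :
    M.charpolyRev.coeff k = M.charpoly.coeff (Fintype.card n - k) := by
  rw [← reverse_charpoly, coeff_reverse, charpoly_natDegree_eq_dim, revAt_le hk]

theorem coeff_charpolyRev_of_lt (M : Matrix n n R) [Nontrivial R] {k : ℕ}
    (hk : Fintype.card n < k) : M.charpolyRev.coeff k = 0 := by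
  refine coeff_eq_zero_of_natDegree_lt ?_
  rw [← reverse_charpoly]
  exact (reverse_natDegree_le _).trans_lt (by rwa [charpoly_natDegree_eq_dim])

end NewtonIdentities

section CharacteristicCoefficients

open Matrix

theorem charpoly_algEquiv_apply {K n n' : Type*} [Field K] [Fintype n] [DecidableEq n]
    [Fintype n'] [DecidableEq n'] (f : Matrix n n K ≃ₐ[K] Matrix n' n' K) (M : Matrix n n K) :
    (f M).charpoly = M.charpoly := by
  obtain ⟨T, hT⟩ := AlgEquiv.eq_linearEquivConjAlgEquiv
    ((toLinAlgEquiv'.symm.trans f).trans toLinAlgEquiv')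
  have hconj : toLin' (f M) = T.conj (toLin' M) := by
    have h := DFunLike.congr_fun hT (toLinAlgEquiv' M)
    rwa [AlgEquiv.trans_apply, AlgEquiv.trans_apply, AlgEquiv.symm_apply_apply] at h
  rw [← charpoly_toLin', hconj, LinearEquiv.charpoly_conj, charpoly_toLin']

variable {F A I : Type*} [Field F] [Ring A] [Algebra F A] [Fintype I] [DecidableEq I]
  (φ : AlgebraicClosure F ⊗[F] A ≃ₐ[AlgebraicClosure F] Matrix I I (AlgebraicClosure F))

include φ

theorem isCharCoeff_iff (i : ℕ) (a : A) (c : F) :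
    IsCharCoeff F i a c ↔ i ≤ Fintype.card I ∧
      (φ (1 ⊗ₜ[F] a)).charpolyRev.coeff i = algebraMap F (AlgebraicClosure F) c := by
  constructor
  · rintro ⟨d, ψ, hi, hc⟩
    have hcharpoly : (φ (1 ⊗ₜ[F] a)).charpoly = (ψ (1 ⊗ₜ[F] a)).charpoly := by
      simpa using charpoly_algEquiv_apply (ψ.symm.trans φ) (ψ (1 ⊗ₜ[F] a))
    have hd : Fintype.card I = d := by
      simpa [charpoly_natDegree_eq_dim] using congrArg Polynomial.natDegree hcharpoly
    rw [← hd] at hi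
    rw [coeff_charpolyRev_of_le _ hi, hcharpoly, hd]
    exact ⟨hd ▸ hi, hc⟩
  · rintro ⟨hi, hc⟩
    let e := reindexAlgEquiv (AlgebraicClosure F) (AlgebraicClosure F) (Fintype.equivFin I)
    refine ⟨Fintype.card I, φ.trans e, hi, ?_⟩
    rwa [AlgEquiv.trans_apply, charpoly_algEquiv_apply, ← coeff_charpolyRev_of_le _ hi]

theorem algebraMap_charCoeff {i : ℕ} {a : A} (hi : i ≤ Fintype.card I)
    (h : (φ (1 ⊗ₜ[F] a)).charpolyRev.coeff i ∈ (algebraMap F (AlgebraicClosure F)).range) :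
    algebraMap F (AlgebraicClosure F) (charCoeff F i a) =
      (φ (1 ⊗ₜ[F] a)).charpolyRev.coeff i := by
  obtain ⟨c, hc⟩ := h
  have hex : ∃ c, IsCharCoeff F i a c := ⟨c, (isCharCoeff_iff φ i a c).2 ⟨hi, hc.symm⟩⟩
  rw [charCoeff, dif_pos hex]
  exact ((isCharCoeff_iff φ i a _).1 hex.choose_spec).2.symm

theorem trace_pow_eq_zero_of_charCoeff {N : ℕ} (hN : N ≠ 0)
    (hcast : ∀ k : ℕ, 0 < k → k ≤ N → (k : F) ≠ 0) {a : A}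
    (htrace : ∀ k, (φ (1 ⊗ₜ[F] a) ^ k).trace ∈ (algebraMap F (AlgebraicClosure F)).range)
    (ha : ∀ i ∈ Finset.Icc 1 N, charCoeff F i a = 0) : (φ (1 ⊗ₜ[F] a) ^ N).trace = 0 := by
  refine trace_pow_eq_zero_of_coeff_charpolyRev _ hN fun k hk hkN => ?_
  rcases le_or_gt k (Fintype.card I) with hkI | hkI
  · rw [← algebraMap_charCoeff φ hkI (coeff_charpolyRev_mem_range _ htrace hcast k hkN),
      ha k (Finset.mem_Icc.2 ⟨hk, hkN⟩), map_zero]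
  · exact coeff_charpolyRev_of_lt _ hkI

end CharacteristicCoefficients

section MixedProduct

/-- The sum of all products of `i` factors `a` and `j` factors `b`, in any order: the coefficient of
`c ^ j` in `(a + c • b) ^ (i + j)`. -/
def mixedProduct {A : Type*} [Semiring A] (a b : A) : ℕ → ℕ → A
  | 0, 0 => 1
  | i + 1, 0 => a * mixedProduct a b i 0
  | 0, j + 1 => b * mixedProduct a b 0 j
  | i + 1, j + 1 => a * mixedProduct a b i (j + 1) + b * mixedProduct a b (i + 1) j

theorem map_mixedProduct {A B G : Type*} [Semiring A] [Semiring B] [FunLike G A B]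
    [RingHomClass G A B] (f : G) (a b : A) (i j : ℕ) :
    f (mixedProduct a b i j) = mixedProduct (f a) (f b) i j := by
  induction i, j using mixedProduct.induct with
  | case1 => simp [mixedProduct]
  | case2 i ih => simp [mixedProduct, ih]
  | case3 j ih => simp [mixedProduct, ih]
  | case4 i j ih₁ ih₂ => simp [mixedProduct, ih₁, ih₂]

theorem mixedProduct_smul_smul {R A : Type*} [CommSemiring R] [Semiring A] [Algebra R A]
    (s t : R) (a b : A) (i j : ℕ) :
    mixedProduct (s • a) (t • b) i j = (s ^ i * t ^ j) • mixedProduct a b i j := by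
  induction i, j using mixedProduct.induct with
  | case1 => simp [mixedProduct]
  | case2 i ih => simp [mixedProduct, ih, smul_smul, pow_succ]
  | case3 j ih => simp [mixedProduct, ih, smul_smul, pow_succ]
  | case4 i j ih₁ ih₂ =>
    simp only [mixedProduct, ih₁, ih₂, smul_mul_smul_comm, Nat.succ_eq_add_one]
    module

theorem mixedProduct_of_commute {A : Type*} [Semiring A] {a b : A} (h : Commute a b) (i j : ℕ) :
    mixedProduct a b i j = (i + j).choose j • (a ^ i * b ^ j) := by
  induction i, j using mixedProduct.induct with
  | case1 => simp [mixedProduct]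
  | case2 i ih => simp [mixedProduct, ih, pow_succ']
  | case3 j ih => simp [mixedProduct, ih, pow_succ']
  | case4 i j ih₁ ih₂ =>
    have ha : a * (a ^ i * b ^ (j + 1)) = a ^ (i + 1) * b ^ (j + 1) := by
      rw [← mul_assoc, ← pow_succ']
    have hb : b * (a ^ (i + 1) * b ^ j) = a ^ (i + 1) * b ^ (j + 1) := by
      rw [← mul_assoc, ← (h.pow_left (i + 1)).eq, mul_assoc, ← pow_succ']
    rw [mixedProduct, ih₁, ih₂, mul_smul_comm, mul_smul_comm, ha, hb, ← add_smul]
    congr 1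
    rw [Nat.succ_eq_add_one, Nat.succ_eq_add_one, show i + 1 + (j + 1) = i + 1 + j + 1 by ring,
      Nat.choose_succ_succ, add_comm, show i + (j + 1) = i + 1 + j by ring]

variable {R A : Type*} [CommRing R] [Ring A] [Algebra R A]

theorem add_smul_pow_eq_sum_mixedProduct (a b : A) (c : R) (n : ℕ) :
    (a + c • b) ^ n =
      ∑ x ∈ Finset.HasAntidiagonal.antidiagonal n, c ^ x.2 • mixedProduct a b x.1 x.2 := by
  induction n with
  | zero => simp [mixedProduct]
  | succ n ih =>
    let startingWithA : ℕ × ℕ → A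
      | (0, _) => 0
      | (i + 1, j) => c ^ j • (a * mixedProduct a b i j)
    let startingWithB : ℕ × ℕ → A
      | (_, 0) => 0
      | (i, j + 1) => c ^ (j + 1) • (b * mixedProduct a b i j)
    have hsplit : ∀ x ∈ Finset.HasAntidiagonal.antidiagonal (n + 1),
        c ^ x.2 • mixedProduct a b x.1 x.2 = startingWithA x + startingWithB x := by
      rintro ⟨_ | i, _ | j⟩ hx
      · simp at hx
      all_goals simp [startingWithA, startingWithB, mixedProduct]
    rw [Finset.sum_congr rfl hsplit, Finset.sum_add_distrib, Finset.Nat.sum_antidiagonal_succ,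
      Finset.Nat.sum_antidiagonal_succ', pow_succ', ih, add_mul]
    simp only [startingWithA, startingWithB, Finset.mul_sum, zero_add, smul_mul_assoc,
      mul_smul_comm, smul_smul, pow_succ]

open Polynomial in
theorem map_mixedProduct_eq_zero [IsDomain R] (T : A →ₗ[R] R) (a b : A) {i j : ℕ} (s : Finset R)
    (hs : i + j < s.card) (hT : ∀ c ∈ s, T ((a + c • b) ^ (i + j)) = 0) :
    T (mixedProduct a b i j) = 0 := by
  let P : R[X] := ∑ x ∈ Finset.HasAntidiagonal.antidiagonal (i + j),
    monomial x.2 (T (mixedProduct a b x.1 x.2))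
  have hdeg : P.natDegree ≤ i + j :=
    natDegree_sum_le_of_forall_le _ _ fun x hx => (natDegree_monomial_le _).trans
      (Finset.HasAntidiagonal.antidiagonal.snd_le hx)
  have hP : P = 0 := by
    refine eq_zero_of_natDegree_lt_card_of_eval_eq_zero' P s (fun c hc => ?_) (hdeg.trans_lt hs)
    rw [← hT c hc, add_smul_pow_eq_sum_mixedProduct, map_sum, eval_finsetSum]
    refine Finset.sum_congr rfl fun x _ => ?_
    rw [eval_monomial, map_smul, smul_eq_mul, mul_comm]
  have hcoeff : P.coeff j = T (mixedProduct a b i j) := by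
    simp only [P, finsetSum_coeff, coeff_monomial]
    rw [Finset.sum_eq_single_of_mem (i, j) (by simp), if_pos rfl]
    rintro ⟨i', j'⟩ hx hne
    refine if_neg fun h => hne ?_
    rw [Finset.HasAntidiagonal.mem_antidiagonal] at hx
    grind
  rw [← hcoeff, hP, coeff_zero]

end MixedProduct

section Reduction

open IsLocalRing (ResidueField residue)

variable {K I : Type*} [Field K] {𝒪 : ValuationSubring K}

/-- The matrix `Z` is `t` times a matrix with entries in the valuation ring `𝒪`, and the reduction
of that matrix to the residue field is `W`. For `W ≠ 0` this says that `t • W` is the leading term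
of `Z`. -/
def ReducesTo (t : K) (Z : Matrix I I K) (W : Matrix I I (ResidueField 𝒪)) : Prop :=
  ∃ Y : Matrix I I 𝒪, Z = t • Y.map (algebraMap 𝒪 K) ∧ Y.map (residue 𝒪) = W

namespace ReducesTo

variable {t t' : K} {Z Z' : Matrix I I K} {W W' : Matrix I I (ResidueField 𝒪)}

theorem smul (c : K) (h : ReducesTo t Z W) : ReducesTo (c * t) (c • Z) W := by
  obtain ⟨Y, rfl, rfl⟩ := h
  exact ⟨Y, smul_smul _ _ _, rfl⟩

theorem sum {ι : Type*} {s : Finset ι} {Z : ι → Matrix I I K}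
    {W : ι → Matrix I I (ResidueField 𝒪)} (h : ∀ i ∈ s, ReducesTo t (Z i) (W i)) :
    ReducesTo t (∑ i ∈ s, Z i) (∑ i ∈ s, W i) := by
  choose! Y hZ hW using h
  refine ⟨∑ i ∈ s, Y i, ?_, ?_⟩
  · rw [Finset.sum_congr rfl hZ, ← Finset.smul_sum]
    exact congrArg _ (map_sum (algebraMap 𝒪 K).toAddMonoidHom.mapMatrix Y s).symm
  · rw [← Finset.sum_congr rfl hW]
    exact map_sum (residue 𝒪).toAddMonoidHom.mapMatrix Y s

theorem mixedProduct [Fintype I] [DecidableEq I] (h : ReducesTo t Z W) (h' : ReducesTo t' Z' W')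
    (i j : ℕ) :
    ReducesTo (t ^ i * t' ^ j) (_root_.mixedProduct Z Z' i j) (_root_.mixedProduct W W' i j) := by
  obtain ⟨Y, rfl, rfl⟩ := h
  obtain ⟨Y', rfl, rfl⟩ := h'
  refine ⟨_root_.mixedProduct Y Y' i j, ?_, map_mixedProduct (residue 𝒪).mapMatrix Y Y' i j⟩
  rw [mixedProduct_smul_smul]
  exact congrArg _ (map_mixedProduct (algebraMap 𝒪 K).mapMatrix Y Y' i j).symm

theorem zero_of_lt (h : ReducesTo t Z W) (hlt : 𝒪.valuation t < 𝒪.valuation t') :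
    ReducesTo t' Z (0 : Matrix I I (ResidueField 𝒪)) := by
  obtain ⟨Y, rfl, -⟩ := h
  have ht' : t' ≠ 0 := 𝒪.valuation.ne_zero_iff.1 (zero_le.trans_lt hlt).ne'
  have hquot : 𝒪.valuation (t / t') < 1 := by
    rwa [map_div₀, div_lt_one₀ (𝒪.valuation.pos_iff.2 ht')]
  let c : 𝒪 := ⟨t / t', (𝒪.valuation_le_one_iff _).1 hquot.le⟩
  have hc : residue 𝒪 c = 0 :=
    (IsLocalRing.residue_eq_zero_iff _).2 ((𝒪.valuation_lt_one_iff c).2 hquot)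
  refine ⟨c • Y, ?_, ?_⟩
  · ext i k
    change t * algebraMap 𝒪 K (Y i k) = t' * (t / t' * algebraMap 𝒪 K (Y i k))
    rw [← mul_assoc, mul_div_cancel₀ t ht']
  · ext i k
    simp [hc]

theorem unique (h : ReducesTo t Z W) (h' : ReducesTo t Z W') (ht : t ≠ 0) : W = W' := by
  obtain ⟨Y, rfl, rfl⟩ := h
  obtain ⟨Y', hY, rfl⟩ := h'
  have hmap := smul_right_injective _ ht hY
  rw [Matrix.map_injective (FaithfulSMul.algebraMap_injective 𝒪 K) hmap]

theorem valuation_le (h : ReducesTo t Z W) (h' : ReducesTo t' Z W') (hW : W ≠ 0) :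
    𝒪.valuation t ≤ 𝒪.valuation t' := by
  by_contra! hlt
  exact hW (h.unique (h'.zero_of_lt hlt) (𝒪.valuation.ne_zero_iff.1 (zero_le.trans_lt hlt).ne'))

theorem valuation_eq (h : ReducesTo t Z W) (h' : ReducesTo t' Z W') (hW : W ≠ 0) (hW' : W' ≠ 0) :
    𝒪.valuation t = 𝒪.valuation t' :=
  (h.valuation_le h' hW).antisymm (h'.valuation_le h hW')

theorem sum_of_forall_lt {ι : Type*} {s : Finset ι} {t : ι → K} {Z : ι → Matrix I I K}
    {W : ι → Matrix I I (ResidueField 𝒪)} (h : ∀ i ∈ s, ReducesTo (t i) (Z i) (W i)) {i₀ : ι}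
    (hi₀ : i₀ ∈ s) (hlt : ∀ i ∈ s, i ≠ i₀ → 𝒪.valuation (t i) < 𝒪.valuation (t i₀)) :
    ReducesTo (t i₀) (∑ i ∈ s, Z i) (W i₀) := by
  classical
  have hsingle := ReducesTo.sum (t := t i₀) (s := s) (Z := Z)
    (W := fun i => if i = i₀ then W i₀ else 0) fun i hi => by
      split_ifs with hii
      · exact hii ▸ h i hi
      · exact (h i hi).zero_of_lt (hlt i hi hii)
  simpa only [Finset.sum_ite_eq', if_pos hi₀] using hsingle

end ReducesTo

end Reduction

section Counting

theorem ncard_le_of_smul_mem_imp_eq {k V : Type*} [Field k] [Finite k] [AddCommGroup V] [Module k V]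
    [Finite V] {S : Set V} (hzero : 0 ∉ S) (hline : ∀ v ∈ S, ∀ c : k, c • v ∈ S → c • v = v) :
    S.ncard ≤ (Nat.card V - 1) / (Nat.card k - 1) := by
  have hne (v : S) : (v : V) ≠ 0 := fun h => hzero (h ▸ v.2)
  rw [← Projectivization.card'' k V, ← Nat.card_coe_set_eq]
  refine Nat.card_le_card_of_injective (fun v : S => Projectivization.mk k v.1 (hne v)) ?_
  intro v w hvw
  obtain ⟨c, hc⟩ := (Projectivization.mk_eq_mk_iff' k _ _ (hne v) (hne w)).1 hvw
  exact Subtype.ext (hc.symm.trans (hline w w.2 c (hc ▸ v.2)))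

theorem eq_of_add_eq_smul_add {p : ℕ} [Fact p.Prime] {V : Type*} [AddCommGroup V]
    [Module (ZMod p) V] {s s' t : V} {c : ZMod p} (h : s' + t = c • (s + t))
    (hne : ∀ i j : ℕ, i + j = p - 1 → i • s + j • s' ≠ t) : s' = s := by
  by_contra hs
  have hc : c - 1 ≠ 0 := fun hc => hs <| by
    rw [sub_eq_zero.1 hc, one_smul] at h
    exact add_right_cancel h
  have hlt : ((c - 1)⁻¹ : ZMod p).val < p := ZMod.val_lt _
  -- For `i + j = -1` and `j = (c - 1)⁻¹` we have `i • s + j • s' = -s + j • (s' - s) = t`.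
  refine hne (p - 1 - ((c - 1)⁻¹ : ZMod p).val) ((c - 1)⁻¹ : ZMod p).val (by omega) ?_
  have hs' : s' = s + (c - 1) • (s + t) := by
    rw [sub_smul, ← h, one_smul]
    abel
  rw [← Nat.cast_smul_eq_nsmul (ZMod p), ← Nat.cast_smul_eq_nsmul (ZMod p),
    Nat.cast_sub (by omega), Nat.cast_pred (Fact.out : p.Prime).pos, CharP.cast_eq_zero,
    ZMod.natCast_zmod_val, hs', smul_add, inv_smul_smul₀ hc]
  module

theorem ncard_le_of_nsmul_add_nsmul_ne {p : ℕ} [Fact p.Prime] {V : Type*} [AddCommGroup V]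
    [Module (ZMod p) V] [Finite V] (S : Set V) (t : V)
    (hS : ∀ s ∈ S, ∀ s' ∈ S, ∀ c : ZMod p, s' + t = c • (s + t) → ∀ i j : ℕ, i + j = p - 1 →
      i • s + j • s' ≠ t) :
    S.ncard ≤ (Nat.card V - 1) / (p - 1) := by
  rw [← Set.ncard_image_of_injective S (add_left_injective t)]
  refine (ncard_le_of_smul_mem_imp_eq (k := ZMod p) ?_ ?_).trans_eq (by rw [Nat.card_zmod])
  · rintro ⟨s, hs, hst : s + t = 0⟩
    refine hS s hs s hs 1 (one_smul _ _).symm (p - 1) 0 (add_zero _) ?_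
    rw [zero_smul, add_zero, ← Nat.cast_smul_eq_nsmul (ZMod p),
      Nat.cast_pred (Fact.out : p.Prime).pos, CharP.cast_eq_zero, zero_sub, neg_one_smul]
    exact neg_eq_of_add_eq_zero_right hst
  · rintro _ ⟨s, hs, rfl⟩ c ⟨s', hs', hc : s' + t = c • (s + t)⟩
    rw [← hc, eq_of_add_eq_smul_add hc (hS s hs s' hs' c hc)]

end Counting

section ClockShift

variable {p : ℕ} {ι κ : Type*} [Fintype ι] [CommRing κ] (χ : AddChar (ZMod p) κ)

/-- The monomial matrix that multiplies the shift by `u ∘ Sum.inr` with the character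
`i ↦ χ (u ∘ Sum.inl ⬝ᵥ i)`. -/
def clockShift (u : ι ⊕ ι → ZMod p) : Matrix (ι → ZMod p) (ι → ZMod p) κ :=
  Matrix.of fun i k => if k = i + u ∘ Sum.inr then χ ((u ∘ Sum.inl) ⬝ᵥ i) else 0

theorem clockShift_apply (u : ι ⊕ ι → ZMod p) (i k : ι → ZMod p) :
    clockShift χ u i k = if k = i + u ∘ Sum.inr then χ ((u ∘ Sum.inl) ⬝ᵥ i) else 0 := rfl

theorem clockShift_ne_zero [Nontrivial κ] (u : ι ⊕ ι → ZMod p) : clockShift χ u ≠ 0 := by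
  intro h
  have hentry : clockShift χ u 0 (0 + u ∘ Sum.inr) = 1 := by simp [clockShift_apply]
  exact zero_ne_one (hentry.symm.trans (congrFun₂ h _ _)).symm

theorem clockShift_zero : clockShift χ (0 : ι ⊕ ι → ZMod p) = 1 := by
  ext i k
  simp [clockShift_apply, Matrix.one_apply, eq_comm]

variable [DecidableEq ι] [NeZero p]

theorem clockShift_mul (u w : ι ⊕ ι → ZMod p) :
    clockShift χ u * clockShift χ w =
      χ ((w ∘ Sum.inl) ⬝ᵥ (u ∘ Sum.inr)) • clockShift χ (u + w) := by
  ext i k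
  rw [Matrix.mul_apply, Finset.sum_eq_single (i + u ∘ Sum.inr)]
  · simp only [clockShift_apply, Matrix.smul_apply, if_true, Pi.add_comp, smul_eq_mul, mul_ite,
      mul_zero, dotProduct_add, add_dotProduct, AddChar.map_add_eq_mul, add_assoc]
    split_ifs
    · ring
    · rfl
  · intro l _ hl
    rw [clockShift_apply, if_neg hl, zero_mul]
  · simp

theorem clockShift_pow (u : ι ⊕ ι → ZMod p) (n : ℕ) :
    ∃ x, clockShift χ u ^ n = χ x • clockShift χ (n • u) := by
  induction n with
  | zero => exact ⟨0, by simp [clockShift_zero]⟩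
  | succ n ih =>
    obtain ⟨x, hx⟩ := ih
    refine ⟨x + ((u ∘ Sum.inl) ⬝ᵥ ((n • u) ∘ Sum.inr)), ?_⟩
    rw [pow_succ, hx, smul_mul_assoc, clockShift_mul, smul_smul, AddChar.map_add_eq_mul, succ_nsmul]

theorem clockShift_pow_mul_pow (u w : ι ⊕ ι → ZMod p) (i j : ℕ) :
    ∃ x, clockShift χ u ^ i * clockShift χ w ^ j = χ x • clockShift χ (i • u + j • w) := by
  obtain ⟨x, hx⟩ := clockShift_pow χ u i
  obtain ⟨y, hy⟩ := clockShift_pow χ w j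
  refine ⟨x + y + (((j • w) ∘ Sum.inl) ⬝ᵥ ((i • u) ∘ Sum.inr)), ?_⟩
  rw [hx, hy, smul_mul_smul_comm, clockShift_mul, smul_smul, AddChar.map_add_eq_mul,
    AddChar.map_add_eq_mul]

theorem clockShift_commute_smul (u : ι ⊕ ι → ZMod p) (c : ZMod p) :
    Commute (clockShift χ u) (clockShift χ (c • u)) := by
  rw [Commute, SemiconjBy, clockShift_mul, clockShift_mul, add_comm (c • u)]
  congr 2
  change (c • (u ∘ Sum.inl)) ⬝ᵥ (u ∘ Sum.inr) = (u ∘ Sum.inl) ⬝ᵥ (c • (u ∘ Sum.inr))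
  rw [smul_dotProduct, dotProduct_smul]

theorem clockShift_one_commute (u w : ι ⊕ ι → ZMod p) :
    Commute (clockShift (1 : AddChar (ZMod p) κ) u) (clockShift 1 w) := by
  rw [Commute, SemiconjBy, clockShift_mul, clockShift_mul, add_comm w, AddChar.one_apply,
    AddChar.one_apply]

end ClockShift

/-- A representation of an `F`-algebra `A` by matrices over `K` in which a spanning family of `A`,
indexed by pairs of exponent vectors modulo `p`, acts by the monomial matrices of a tensor product
of symbol algebras: the generators indexed by `Sum.inl` act diagonally with eigenvalues `g j`, those
indexed by `Sum.inr` as `η j` times a cyclic shift. -/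
structure SymbolRep (p : ℕ) [NeZero p] (ι F K A : Type*) [Fintype ι] [DecidableEq ι] [Field F]
    [Field K] [Algebra F K] [Ring A] [Algebra F A] where
  toHom : A →ₐ[F] Matrix (ι → ZMod p) (ι → ZMod p) K
  gen : (ι ⊕ ι → ZMod p) → A
  span_gen : Submodule.span F (Set.range gen) = ⊤
  g : ι → ZMod p → K
  g_injective : ∀ j, Function.Injective (g j)
  η : ι → K
  η_ne_zero : ∀ j, η j ≠ 0
  toHom_gen : ∀ u i k, toHom (gen u) i k = if k = i + u ∘ Sum.inr then
    ∏ j, (g j (i j) ^ (u (Sum.inl j)).val * η j ^ (u (Sum.inr j)).val) else 0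

theorem eq_zero_of_sum_mul_prod_pow_val_eq_zero {p : ℕ} [NeZero p] {ι K : Type*} [Fintype ι]
    [DecidableEq ι] [Field K] {g : ι → ZMod p → K} (hg : ∀ j, Function.Injective (g j))
    {c : (ι → ZMod p) → K}
    (hc : ∀ i : ι → ZMod p, ∑ a, c a * ∏ j, g j (i j) ^ (a j).val = 0) : c = 0 := by
  classical
  let e (a : ι → ZMod p) : ι →₀ ℕ := Finsupp.equivFunOnFinite.symm fun j => (a j).val
  have he : Function.Injective e := fun a b hab =>
    funext fun j => ZMod.val_injective p (DFunLike.congr_fun hab j)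
  let P : MvPolynomial ι K := ∑ a, MvPolynomial.monomial (e a) (c a)
  have hdeg (j : ι) : P.degreeOf j < (Finset.univ.image (g j)).card := by
    rw [Finset.card_image_of_injective _ (hg j), Finset.card_univ, ZMod.card,
      MvPolynomial.degreeOf_lt_iff (NeZero.pos p)]
    intro m hm
    rw [MvPolynomial.mem_support_iff, MvPolynomial.coeff_sum] at hm
    obtain ⟨a, -, ha⟩ := Finset.exists_ne_zero_of_sum_ne_zero hm
    obtain rfl : e a = m := by_contra fun h => ha (by rw [MvPolynomial.coeff_monomial, if_neg h])
    exact ZMod.val_lt (a j)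
  have hP : P = 0 := by
    refine MvPolynomial.eq_zero_of_eval_zero_at_prod_finset P _ hdeg fun x hx => ?_
    choose i hi using fun j => Finset.mem_image.1 (hx j)
    obtain rfl : (fun j => g j (i j)) = x := funext fun j => (hi j).2
    rw [map_sum, ← hc i]
    refine Finset.sum_congr rfl fun a _ => ?_
    rw [MvPolynomial.eval_monomial, Finsupp.prod_fintype _ _ fun j => pow_zero _]
    rfl
  funext a
  have hcoeff : P.coeff (e a) = c a := by
    simp only [P, MvPolynomial.coeff_sum, MvPolynomial.coeff_monomial, he.eq_iff]
    rw [Finset.sum_ite_eq', if_pos (Finset.mem_univ a)]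
  rw [← hcoeff, hP, MvPolynomial.coeff_zero, Pi.zero_apply]

namespace SymbolRep

variable {p : ℕ} [NeZero p] {ι F K A : Type*} [Fintype ι] [DecidableEq ι] [Field F] [Field K]
    [Algebra F K] [Ring A] [Algebra F A] (R : SymbolRep p ι F K A)

theorem linearIndependent_toHom_gen : LinearIndependent K fun u => R.toHom (R.gen u) := by
  rw [Fintype.linearIndependent_iff]
  intro c hc u
  have hη : ∏ j, R.η j ^ (u (Sum.inr j)).val ≠ 0 :=
    Finset.prod_ne_zero_iff.2 fun j _ => pow_ne_zero _ (R.η_ne_zero j)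
  let d (a : ι → ZMod p) : K :=
    c (Sum.elim a (u ∘ Sum.inr)) * ∏ j, R.η j ^ (u (Sum.inr j)).val
  have hd (i : ι → ZMod p) : ∑ a, d a * ∏ j, R.g j (i j) ^ (a j).val = 0 := by
    have hentry := congrFun₂ hc i (i + u ∘ Sum.inr)
    simp only [Matrix.sum_apply, Matrix.smul_apply, R.toHom_gen, add_right_inj,
      Matrix.zero_apply, smul_eq_mul, mul_ite, mul_zero] at hentry
    rw [← hentry, ← Finset.sum_filter]
    refine Finset.sum_nbij' (fun a => Sum.elim a (u ∘ Sum.inr)) (· ∘ Sum.inl) (by simp) (by simp)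
      (fun a _ => Sum.elim_comp_inl _ _) (fun w hw => ?_) fun a _ => ?_
    · rw [(Finset.mem_filter.1 hw).2, Sum.elim_comp_inl_inr]
    · simp only [d, Sum.elim_inl, Sum.elim_inr, Finset.prod_mul_distrib, Function.comp_apply]
      ring
  have hcu := congrFun (eq_zero_of_sum_mul_prod_pow_val_eq_zero R.g_injective hd) (u ∘ Sum.inl)
  simpa only [d, Sum.elim_comp_inl_inr, Pi.zero_apply, mul_eq_zero, hη, or_false] using hcu

theorem linearIndependent_gen : LinearIndependent F R.gen :=
  (R.linearIndependent_toHom_gen.restrict_scalars' F).of_comp R.toHom.toLinearMap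

/-- The spanning family of a `SymbolRep`, as a basis. -/
noncomputable def basis : Module.Basis (ι ⊕ ι → ZMod p) F A :=
  Module.Basis.mk R.linearIndependent_gen R.span_gen.ge

@[simp]
theorem basis_apply (u) : R.basis u = R.gen u := by simp [basis]

theorem repr_gen (u) : R.basis.repr (R.gen u) = Finsupp.single u 1 := by
  rw [← R.basis_apply, R.basis.repr_self]

theorem exists_algEquiv : ∃ φ : K ⊗[F] A ≃ₐ[K] Matrix (ι → ZMod p) (ι → ZMod p) K,
    ∀ a, φ (1 ⊗ₜ[F] a) = R.toHom a := by
  let ψ : K ⊗[F] A →ₐ[K] Matrix (ι → ZMod p) (ι → ZMod p) K :=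
    Algebra.TensorProduct.lift (Algebra.ofId _ _) R.toHom fun _ _ => Algebra.commutes _ _
  have hψ (a : A) : ψ (1 ⊗ₜ[F] a) = R.toHom a :=
    (Algebra.TensorProduct.lift_tmul _ _ _ _ _).trans (by rw [map_one, one_mul])
  let matrixBasis := basisOfLinearIndependentOfCardEqFinrank R.linearIndependent_toHom_gen
    (by simp [Module.finrank_matrix, pow_add])
  have hbasis : ψ.toLinearMap = (R.basis.baseChange K).equiv matrixBasis (Equiv.refl _) :=
    (R.basis.baseChange K).ext fun u => by
      rw [LinearEquiv.coe_coe, Module.Basis.equiv_apply]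
      simp [matrixBasis, hψ]
  have hbij : Function.Bijective ψ := by
    rw [← AlgHom.coe_toLinearMap, hbasis]
    exact LinearEquiv.bijective _
  exact ⟨AlgEquiv.ofBijective ψ hbij, hψ⟩

theorem trace_toHom_gen (u : ι ⊕ ι → ZMod p) :
    (R.toHom (R.gen u)).trace =
      if u ∘ Sum.inr = 0 then ∏ j, ∑ i, R.g j i ^ (u (Sum.inl j)).val else 0 := by
  simp only [Matrix.trace, Matrix.diag_apply, R.toHom_gen, left_eq_add]
  split_ifs with h
  · rw [Fintype.prod_sum]
    refine Finset.sum_congr rfl fun i _ => Finset.prod_congr rfl fun j _ => ?_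
    have hj : u (Sum.inr j) = 0 := congrFun h j
    rw [hj, ZMod.val_zero, pow_zero, mul_one]
  · exact Finset.sum_const_zero

variable {R} in
theorem trace_toHom {t : ZMod p} {θ : F} (ht : ∀ j (a : ZMod p),
      ∑ i, R.g j i ^ a.val = if a = t then algebraMap F K θ else 0) (z : A) :
    (R.toHom z).trace =
      algebraMap F K (θ ^ Fintype.card ι * R.basis.repr z (Sum.elim (fun _ => t) 0)) := by
  have htrace : (Matrix.traceLinearMap _ F K).comp R.toHom.toLinearMap =
      (Algebra.linearMap F K).comp
        (θ ^ Fintype.card ι • R.basis.coord (Sum.elim (fun _ => t) 0)) := by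
    refine R.basis.ext fun u => ?_
    have hu : u = Sum.elim (fun _ => t) 0 ↔ u ∘ Sum.inr = 0 ∧ ∀ j ∈ Finset.univ,
        u (Sum.inl j) = t := by
      simp [funext_iff, and_comm]
    simp only [LinearMap.comp_apply, AlgHom.toLinearMap_apply, Matrix.traceLinearMap_apply,
      LinearMap.smul_apply, Module.Basis.coord_apply, basis_apply, R.repr_gen, R.trace_toHom_gen,
      ht, Finset.prod_ite_zero, Finset.prod_const, Finset.card_univ, Finsupp.single_apply, hu,
      ← ite_and, ← map_pow]
    split_ifs <;> simp
  exact LinearMap.congr_fun htrace z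

end SymbolRep

theorem addChar_map_sum {A M ι : Type*} [AddCommMonoid A] [CommMonoid M] (ψ : AddChar A M)
    (s : Finset ι) (f : ι → A) : ψ (∑ i ∈ s, f i) = ∏ i ∈ s, ψ (f i) :=
  map_prod ψ.toMonoidHom (fun i => Multiplicative.ofAdd (f i)) s

section NatCast

variable {R : Type*} {p : ℕ}

theorem natCast_injOn_range [AddGroupWithOne R] (h : ∀ k : ℕ, 0 < k → k < p → (k : R) ≠ 0) :
    Set.InjOn (Nat.cast : ℕ → R) (Finset.range p) := by
  intro a ha b hb hab
  wlog hle : a ≤ b generalizing a b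
  · exact (this hb ha hab.symm (le_of_not_ge hle)).symm
  rw [Finset.mem_coe, Finset.mem_range] at hb
  by_contra hne
  exact h (b - a) (by omega) (by omega) (by rw [Nat.cast_sub hle, hab, sub_self])

theorem natCast_choose_ne_zero [CommSemiring R] [NoZeroDivisors R] [Nontrivial R]
    (h : ∀ k : ℕ, 0 < k → k < p → (k : R) ≠ 0) {n j : ℕ} (hn : n < p) (hj : j ≤ n) :
    (n.choose j : R) ≠ 0 := by
  have hfactorial : (n.factorial : R) ≠ 0 := by
    rw [← Finset.prod_range_add_one_eq_factorial, Nat.cast_prod, Finset.prod_ne_zero_iff]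
    intro k hk
    exact h (k + 1) k.succ_pos (by rw [Finset.mem_range] at hk; omega)
  rw [← Nat.choose_mul_factorial_mul_factorial hj, Nat.cast_mul, Nat.cast_mul] at hfactorial
  exact left_ne_zero_of_mul (left_ne_zero_of_mul hfactorial)

theorem natCast_residueField_ne_zero_iff {K : Type*} [Field K] {𝒪 : ValuationSubring K} {k : ℕ} :
    (k : IsLocalRing.ResidueField 𝒪) ≠ 0 ↔ 𝒪.valuation (k : K) = 1 := by
  rw [← map_natCast (IsLocalRing.residue 𝒪), IsLocalRing.residue_ne_zero_iff_isUnit,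
    ValuationSubring.valuation_eq_one_iff]
  rfl

theorem natCast_ne_zero_of_residueField (F : Type*) {K : Type*} [Field F] [Field K] [Algebra F K]
    {𝒪 : ValuationSubring K} {k : ℕ} (h : (k : IsLocalRing.ResidueField 𝒪) ≠ 0) : (k : F) ≠ 0 := by
  rw [natCast_residueField_ne_zero_iff, ← map_natCast (algebraMap F K)] at h
  exact (map_ne_zero _).1 ((Valuation.ne_zero_iff _).1 (h.trans_ne one_ne_zero))

end NatCast

section HasWeight

variable {p : ℕ} {σ F K : Type*} [Fintype σ] [Field F] [Field K] [Algebra F K] {s : σ → K}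
    {t t' : K} {w w' : σ → ZMod p}

/-- `t` is a nonzero constant from `F` times a product of integral powers of the `s k`, with
exponents congruent to `w k` modulo `p`. -/
def HasWeight (F : Type*) [Field F] [Algebra F K] (s : σ → K) (t : K) (w : σ → ZMod p) : Prop :=
  ∃ f : F, f ≠ 0 ∧ ∃ n : σ → ℤ, (∀ k, (n k : ZMod p) = w k) ∧
    t = algebraMap F K f * ∏ k, s k ^ n k

namespace HasWeight

theorem ne_zero (hs : ∀ k, s k ≠ 0) (h : HasWeight F s t w) : t ≠ 0 := by
  obtain ⟨f, hf, n, -, rfl⟩ := h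
  exact mul_ne_zero ((map_ne_zero _).2 hf)
    (Finset.prod_ne_zero_iff.2 fun k _ => zpow_ne_zero _ (hs k))

theorem mul (hs : ∀ k, s k ≠ 0) (h : HasWeight F s t w) (h' : HasWeight F s t' w') :
    HasWeight F s (t * t') (w + w') := by
  obtain ⟨f, hf, n, hn, rfl⟩ := h
  obtain ⟨f', hf', n', hn', rfl⟩ := h'
  refine ⟨f * f', mul_ne_zero hf hf', n + n', fun k => by simp [hn, hn'], ?_⟩
  simp only [Pi.add_apply, zpow_add₀ (hs _), Finset.prod_mul_distrib, map_mul]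
  ring

theorem pow (h : HasWeight F s t w) (i : ℕ) : HasWeight F s (t ^ i) (i • w) := by
  obtain ⟨f, hf, n, hn, rfl⟩ := h
  refine ⟨f ^ i, pow_ne_zero i hf, fun k => n k * i, fun k => by simp [hn, mul_comm], ?_⟩
  simp only [zpow_mul, zpow_natCast, Finset.prod_pow, map_pow, mul_pow]

theorem eq_of_valuation_eq {Γ : Type*} [LinearOrderedCommGroupWithZero Γ] {ν : Valuation K Γ}
    (hs : ∀ k, s k ≠ 0) (hindep : ∀ (f : F) (n : σ → ℤ),
      ν (algebraMap F K f * ∏ k, s k ^ n k) = 1 → ∀ k, (p : ℤ) ∣ n k)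
    (h : HasWeight F s t w) (h' : HasWeight F s t' w') (heq : ν t = ν t') : w = w' := by
  have hone : ν (t / t') = 1 := by
    rw [map_div₀, heq, div_self (ν.ne_zero_iff.2 (h'.ne_zero hs))]
  obtain ⟨f, -, n, hn, rfl⟩ := h
  obtain ⟨f', -, n', hn', rfl⟩ := h'
  have hdvd := hindep (f / f') (n - n') <| by
    rw [← hone]
    simp only [Pi.sub_apply, zpow_sub₀ (hs _), Finset.prod_div_distrib, map_div₀, mul_div_mul_comm]
  funext k
  rw [← hn, ← hn', ← sub_eq_zero, ← Int.cast_sub]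
  exact (ZMod.intCast_zmod_eq_zero_iff_dvd _ p).2 (hdvd k)

end HasWeight

end HasWeight

namespace SymbolRep

open IsLocalRing (ResidueField residue)

variable {p : ℕ} [NeZero p] {ι F K A : Type*} [Fintype ι] [DecidableEq ι] [Field F] [Field K]
    [Algebra F K] [Ring A] [Algebra F A] (R : SymbolRep p ι F K A) {𝒪 : ValuationSubring K}
    (ξ : ι → K) (χ : AddChar (ZMod p) (ResidueField 𝒪))

/-- Every eigenvalue `g j i` is `ξ j` times an element of the valuation ring with residue `χ i`, and
the values of the `ξ j` and `η j` are independent modulo `p` over the value group of `F`. -/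
structure IsTame : Prop where
  ξ_ne_zero : ∀ j, ξ j ≠ 0
  exists_g_eq : ∀ j i, ∃ y : 𝒪, R.g j i = ξ j * y ∧ residue 𝒪 y = χ i
  independent : ∀ (f : F) (n : ι ⊕ ι → ℤ),
    𝒪.valuation (algebraMap F K f * ∏ k, Sum.elim ξ R.η k ^ n k) = 1 → ∀ k, (p : ℤ) ∣ n k

/-- The leading term of the matrix of `z` has weight `u`, and its coefficient is proportional to the
monomial matrix `clockShift χ u`. -/
def IsLeadingIndex (z : A) (u : ι ⊕ ι → ZMod p) : Prop :=
  ∃ (t : K) (c : ResidueField 𝒪), HasWeight F (Sum.elim ξ R.η) t u ∧ c ≠ 0 ∧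
    ReducesTo t (R.toHom z) (c • clockShift χ u)

variable {R ξ χ}

namespace IsTame

theorem root_ne_zero (h : R.IsTame ξ χ) (k : ι ⊕ ι) : Sum.elim ξ R.η k ≠ 0 := by
  rcases k with j | j
  exacts [h.ξ_ne_zero j, R.η_ne_zero j]

theorem reducesTo_toHom_gen (h : R.IsTame ξ χ) (u : ι ⊕ ι → ZMod p) :
    ReducesTo (∏ k, Sum.elim ξ R.η k ^ (u k).val) (R.toHom (R.gen u)) (clockShift χ u) := by
  choose y hy hres using h.exists_g_eq
  refine ⟨Matrix.of fun i k => if k = i + u ∘ Sum.inr then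
    ∏ j, y j (i j) ^ (u (Sum.inl j)).val else 0, ?_, ?_⟩
  · ext i k
    rw [R.toHom_gen, Matrix.smul_apply, Matrix.map_apply, Matrix.of_apply,
      apply_ite (algebraMap 𝒪 K), smul_ite, map_zero, smul_zero, map_prod, Fintype.prod_sum_type]
    simp only [hy, mul_pow, Finset.prod_mul_distrib, Sum.elim_inl, Sum.elim_inr, map_pow,
      smul_eq_mul]
    congr 1
    exact mul_right_comm _ _ _
  · ext i k
    rw [Matrix.map_apply, Matrix.of_apply, clockShift_apply, apply_ite (residue 𝒪), map_zero,
      map_prod, dotProduct, addChar_map_sum]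
    simp only [map_pow, hres, ← AddChar.map_nsmul_eq_pow, nsmul_eq_mul, ZMod.natCast_zmod_val,
      Function.comp_apply]

theorem exists_isLeadingIndex (h : R.IsTame ξ χ) {z : A} (hz : z ≠ 0) :
    ∃ u, R.IsLeadingIndex ξ χ z u ∧ R.basis.repr z u ≠ 0 := by
  let t (u : ι ⊕ ι → ZMod p) : K :=
    algebraMap F K (R.basis.repr z u) * ∏ k, Sum.elim ξ R.η k ^ (u k).val
  have hweight {u} (hu : u ∈ (R.basis.repr z).support) : HasWeight F (Sum.elim ξ R.η) (t u) u :=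
    ⟨_, Finsupp.mem_support_iff.1 hu, fun k => (u k).val, fun k => by simp, by
      simp only [t, zpow_natCast]⟩
  have hreduces (u) (_ : u ∈ (R.basis.repr z).support) :
      ReducesTo (t u) (R.basis.repr z u • R.toHom (R.gen u)) (clockShift χ u) := by
    rw [← algebraMap_smul K]
    exact (h.reducesTo_toHom_gen u).smul _
  have hsum : R.toHom z = ∑ u ∈ (R.basis.repr z).support,
      R.basis.repr z u • R.toHom (R.gen u) := by
    conv_lhs => rw [← R.basis.linearCombination_repr z, Finsupp.linearCombination_apply,
      Finsupp.sum, map_sum]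
    simp only [map_smul, basis_apply]
  obtain ⟨u₀, hu₀, hmax⟩ := (R.basis.repr z).support.exists_max_image (fun u => 𝒪.valuation (t u))
    (Finsupp.support_nonempty_iff.2 ((map_ne_zero_iff _ R.basis.repr.injective).2 hz))
  refine ⟨u₀, ⟨t u₀, 1, hweight hu₀, one_ne_zero, ?_⟩, Finsupp.mem_support_iff.1 hu₀⟩
  rw [one_smul, hsum]
  refine ReducesTo.sum_of_forall_lt hreduces hu₀ fun u hu hne => (hmax u hu).lt_of_ne fun heq => ?_
  exact hne (HasWeight.eq_of_valuation_eq h.root_ne_zero h.independent (hweight hu) (hweight hu₀)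
    heq)

end IsTame

namespace IsLeadingIndex

variable {z z' : A} {u u' : ι ⊕ ι → ZMod p}

theorem unique (h : R.IsTame ξ χ) (hu : R.IsLeadingIndex ξ χ z u)
    (hu' : R.IsLeadingIndex ξ χ z u') : u = u' := by
  obtain ⟨t, c, ht, hc, hz⟩ := hu
  obtain ⟨t', c', ht', hc', hz'⟩ := hu'
  exact ht.eq_of_valuation_eq h.root_ne_zero h.independent ht' <|
    hz.valuation_eq hz' (smul_ne_zero hc (clockShift_ne_zero χ u))
      (smul_ne_zero hc' (clockShift_ne_zero χ u'))

theorem ne_zero (h : R.IsTame ξ χ) (hu : R.IsLeadingIndex ξ χ z u) : z ≠ 0 := by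
  rintro rfl
  obtain ⟨t, c, ht, hc, hz⟩ := hu
  have hzero : ReducesTo t (R.toHom 0) (0 : Matrix _ _ (ResidueField 𝒪)) :=
    ⟨0, by rw [map_zero, Matrix.map_zero _ (map_zero _), smul_zero], Matrix.map_zero _ (map_zero _)⟩
  exact smul_ne_zero hc (clockShift_ne_zero χ u) (hz.unique hzero (ht.ne_zero h.root_ne_zero))

theorem repr_ne_zero (h : R.IsTame ξ χ) (hu : R.IsLeadingIndex ξ χ z u) :
    R.basis.repr z u ≠ 0 := by
  obtain ⟨w, hw, hwz⟩ := h.exists_isLeadingIndex (hu.ne_zero h)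
  exact hu.unique h hw ▸ hwz

theorem mixedProduct (h : R.IsTame ξ χ) (hu : R.IsLeadingIndex ξ χ z u)
    (hu' : R.IsLeadingIndex ξ χ z' u') (hcomm : Commute (clockShift χ u) (clockShift χ u'))
    {i j : ℕ} (hchoose : ((i + j).choose j : ResidueField 𝒪) ≠ 0) :
    R.IsLeadingIndex ξ χ (_root_.mixedProduct z z' i j) (i • u + j • u') := by
  obtain ⟨t, c, ht, hc, hz⟩ := hu
  obtain ⟨t', c', ht', hc', hz'⟩ := hu'
  obtain ⟨x, hx⟩ := clockShift_pow_mul_pow χ u u' i j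
  refine ⟨t ^ i * t' ^ j, c ^ i * c' ^ j * (i + j).choose j * χ x,
    (ht.pow i).mul h.root_ne_zero (ht'.pow j), ?_, ?_⟩
  · exact mul_ne_zero (mul_ne_zero (mul_ne_zero (pow_ne_zero i hc) (pow_ne_zero j hc')) hchoose)
      (χ.val_isUnit x).ne_zero
  · have hmixed := hz.mixedProduct hz' i j
    rwa [← map_mixedProduct, mixedProduct_smul_smul, mixedProduct_of_commute hcomm, hx,
      ← Nat.cast_smul_eq_nsmul (ResidueField 𝒪), smul_smul, smul_smul] at hmixed

end IsLeadingIndex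

theorem IsTame.nsmul_add_nsmul_ne (h : R.IsTame ξ χ)
    (hcast : ∀ k : ℕ, 0 < k → k < p → (k : ResidueField 𝒪) ≠ 0) {t : ι ⊕ ι → ZMod p}
    {V : Submodule F A} (hV : ∀ v ∈ V, R.basis.repr (v ^ (p - 1)) t = 0) {v v' : A} (hv : v ∈ V)
    (hv' : v' ∈ V) {s s' : ι ⊕ ι → ZMod p} (hs : R.IsLeadingIndex ξ χ v s)
    (hs' : R.IsLeadingIndex ξ χ v' s') (hcomm : Commute (clockShift χ s) (clockShift χ s'))
    {i j : ℕ} (hij : i + j = p - 1) : i • s + j • s' ≠ t := by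
  classical
  rintro rfl
  have hp := NeZero.pos p
  refine (hs.mixedProduct h hs' hcomm (natCast_choose_ne_zero hcast (by omega)
    (Nat.le_add_left j i))).repr_ne_zero h ?_
  refine map_mixedProduct_eq_zero (R.basis.coord _) v v' ((Finset.range p).image (Nat.cast : ℕ → F))
    ?_ fun c _ => ?_
  · rw [Finset.card_image_of_injOn (natCast_injOn_range fun k hk hkp =>
      natCast_ne_zero_of_residueField F (hcast k hk hkp)), Finset.card_range]
    omega
  · rw [hij]
    exact hV _ (V.add_mem hv (V.smul_mem c hv'))

theorem IsTame.rank_le [Fact p.Prime] (h : R.IsTame ξ χ)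
    (hcast : ∀ k : ℕ, 0 < k → k < p → (k : ResidueField 𝒪) ≠ 0) {t : ι ⊕ ι → ZMod p}
    (ht : χ = 1 ∨ t = 0) (V : Submodule F A)
    (hV : ∀ v ∈ V, R.basis.repr (v ^ (p - 1)) t = 0) :
    Module.rank F V ≤ (((p ^ (2 * Fintype.card ι) - 1) / (p - 1) : ℕ) : Cardinal) := by
  let S : Set (ι ⊕ ι → ZMod p) := {u | ∃ v ∈ V, R.IsLeadingIndex ξ χ v u}
  have hcard : S.ncard ≤ (p ^ (2 * Fintype.card ι) - 1) / (p - 1) := by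
    refine (ncard_le_of_nsmul_add_nsmul_ne (p := p) S t ?_).trans_eq (by simp [two_mul])
    rintro s ⟨v, hv, hs⟩ s' ⟨v', hv', hs'⟩ c hc i j hij
    refine h.nsmul_add_nsmul_ne hcast hV hv hv' hs hs' ?_ hij
    rcases ht with rfl | rfl
    · exact clockShift_one_commute s s'
    · rw [add_zero, add_zero] at hc
      exact hc ▸ clockShift_commute_smul χ s c
  let coords : V →ₗ[F] S → F := LinearMap.pi fun s => (R.basis.coord s).comp V.subtype
  have hcoords : Function.Injective coords := by
    rw [← LinearMap.ker_eq_bot, LinearMap.ker_eq_bot']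
    intro v hv
    by_contra hne
    obtain ⟨u, hu, hvu⟩ := h.exists_isLeadingIndex (z := (v : A)) (by simpa using hne)
    exact hvu (congrFun hv ⟨u, v, v.2, hu⟩)
  have hrank := LinearMap.lift_rank_le_of_injective coords hcoords
  have := Fintype.ofFinite S
  rw [rank_fun', Cardinal.lift_natCast, Cardinal.lift_le_nat_iff, ← Nat.card_eq_fintype_card,
    Nat.card_coe_set_eq] at hrank
  exact hrank.trans (by exact_mod_cast hcard)

end SymbolRep

section Span

open Polynomial

variable {R B : Type*} [CommRing R] [Ring B] [Algebra R B] {x y : B} {f : R[X]}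

theorem mul_aeval_eq_aeval_comp_mul (hyx : y * x = aeval x f * y) (q : R[X]) :
    y * aeval x q = aeval x (q.comp f) * y := by
  have hpow (n : ℕ) : y * x ^ n = aeval x f ^ n * y := SemiconjBy.pow_right hyx n
  induction q using Polynomial.induction_on' with
  | add q q' hq hq' => rw [map_add, mul_add, hq, hq', add_comp, map_add, add_mul]
  | monomial n a =>
    rw [← C_mul_X_pow_eq_monomial, C_mul_comp, X_pow_comp, map_mul, map_mul, aeval_C, aeval_X_pow,
      map_pow, ← mul_assoc, ← Algebra.commutes, mul_assoc, hpow, mul_assoc]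

theorem adjoin_mul_adjoin_eq_top (hgen : Algebra.adjoin R {x, y} = ⊤)
    (hyx : y * x = aeval x f * y) :
    (Algebra.adjoin R {x}).toSubmodule * (Algebra.adjoin R {y}).toSubmodule = ⊤ := by
  set S := (Algebra.adjoin R {x}).toSubmodule * (Algebra.adjoin R {y}).toSubmodule
  have hx : x ∈ Algebra.adjoin R {x} := Algebra.self_mem_adjoin_singleton R x
  have hy : y ∈ Algebra.adjoin R {y} := Algebra.self_mem_adjoin_singleton R y
  have hstable (b : B) : ∀ s ∈ S, b * s ∈ S := by
    have hb : b ∈ Algebra.adjoin R {x, y} := hgen ▸ Algebra.mem_top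
    induction hb using Algebra.adjoin_induction with
    | mem b hb =>
      refine fun s hs => Submodule.mul_induction_on hs (fun c hc d hd => ?_) fun s t hs ht => ?_
      · rw [Subalgebra.mem_toSubmodule] at hc hd
        rcases hb with rfl | rfl
        · rw [← mul_assoc]
          exact Submodule.mul_mem_mul (Subalgebra.mul_mem _ hx hc) hd
        · obtain ⟨q, rfl⟩ := (Algebra.adjoin_singleton_eq_range_aeval R x ▸ hc :)
          change b * (aeval x q * d) ∈ S
          rw [← mul_assoc, mul_aeval_eq_aeval_comp_mul hyx, mul_assoc]
          exact Submodule.mul_mem_mul (aeval_mem_adjoin_singleton R x) (Subalgebra.mul_mem _ hy hd)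
      · rw [mul_add]
        exact S.add_mem hs ht
    | algebraMap r => exact fun s hs => Algebra.smul_def r s ▸ S.smul_mem r hs
    | add b c _ _ hb hc => exact fun s hs => add_mul b c s ▸ S.add_mem (hb s hs) (hc s hs)
    | mul b c _ _ hb hc => exact fun s hs => mul_assoc b c s ▸ hb _ (hc s hs)
  have hone : (1 : B) ∈ S := mul_one (1 : B) ▸ Submodule.mul_mem_mul (Subalgebra.one_mem _)
    (Subalgebra.one_mem _)
  exact eq_top_iff.2 fun b _ => mul_one b ▸ hstable b 1 hone

theorem span_pow_mul_pow_eq_top {P Q : R[X]} (hP : P.Monic) (hPx : aeval x P = 0) (hQ : Q.Monic)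
    (hQy : aeval y Q = 0) (hgen : Algebra.adjoin R {x, y} = ⊤) (hyx : y * x = aeval x f * y) :
    Submodule.span R (Set.range fun q : Fin P.natDegree × Fin Q.natDegree =>
      x ^ (q.1 : ℕ) * y ^ (q.2 : ℕ)) = ⊤ := by
  classical
  rw [← adjoin_mul_adjoin_eq_top hgen hyx, ← Submodule.span_range_natDegree_eq_adjoin hP hPx,
    ← Submodule.span_range_natDegree_eq_adjoin hQ hQy, Submodule.span_mul_span]
  congr 1
  ext b
  simp [Set.mem_mul, Fin.exists_iff]

theorem adjoin_mkAlgHom_ι_eq_top (r : FreeAlgebra R (Fin 2) → FreeAlgebra R (Fin 2) → Prop) :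
    Algebra.adjoin R {RingQuot.mkAlgHom R r (FreeAlgebra.ι R 0),
      RingQuot.mkAlgHom R r (FreeAlgebra.ι R 1)} = ⊤ := by
  have hmap := congrArg (Subalgebra.map (RingQuot.mkAlgHom R r))
    (FreeAlgebra.adjoin_range_ι R (Fin 2))
  rw [AlgHom.map_adjoin, Algebra.map_top,
    (AlgHom.range_eq_top _).2 (RingQuot.mkAlgHom_surjective R r), ← Set.range_comp] at hmap
  rw [← hmap]
  congr 1
  ext z
  simp [Set.mem_range, Fin.exists_fin_two, eq_comm]

end Span

section ShiftMatrix

variable (p : ℕ) [NeZero p] (K : Type*) [CommRing K]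

/-- The `p × p` matrix of the cyclic shift. -/
def shiftMatrix : Matrix (ZMod p) (ZMod p) K := Matrix.of fun i k => if k = i + 1 then 1 else 0

theorem shiftMatrix_pow_apply (n : ℕ) (i k : ZMod p) :
    (shiftMatrix p K ^ n) i k = if k = i + n then 1 else 0 := by
  induction n generalizing k with
  | zero => simp [Matrix.one_apply, eq_comm]
  | succ n ih =>
    rw [pow_succ, Matrix.mul_apply, Finset.sum_eq_single (i + n)]
    · rw [ih, if_pos rfl, one_mul]
      simp [shiftMatrix, add_assoc]
    · intro l _ hl
      rw [ih, if_neg hl, zero_mul]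
    · simp

variable {p K}

theorem smul_shiftMatrix_pow_self (η : K) :
    (η • shiftMatrix p K) ^ p = algebraMap K (Matrix (ZMod p) (ZMod p) K) (η ^ p) := by
  have hshift : shiftMatrix p K ^ p = 1 := by
    ext i k
    simp [shiftMatrix_pow_apply, Matrix.one_apply, eq_comm]
  rw [smul_pow, hshift, Algebra.algebraMap_eq_smul_one]

theorem smul_shiftMatrix_mul_diagonal (η : K) (d : ZMod p → K) :
    η • shiftMatrix p K * Matrix.diagonal d =
      Matrix.diagonal (fun i => d (i + 1)) * η • shiftMatrix p K := by
  ext i k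
  rw [Matrix.mul_diagonal, Matrix.diagonal_mul, mul_comm]
  simp only [shiftMatrix, Matrix.smul_apply, Matrix.of_apply]
  split_ifs with h
  · rw [h]
  · simp

theorem diagonal_pow_mul_shiftMatrix_pow_apply (d : ZMod p → K) (η : K) (a b : ℕ) (i k : ZMod p) :
    (Matrix.diagonal d ^ a * (η • shiftMatrix p K) ^ b) i k =
      if k = i + b then d i ^ a * η ^ b else 0 := by
  rw [Matrix.diagonal_pow, Matrix.diagonal_mul, smul_pow, Matrix.smul_apply, shiftMatrix_pow_apply]
  simp

end ShiftMatrix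

section Kronecker

variable {F K ι n : Type*} [CommRing F] [CommRing K] [Algebra F K] [Fintype ι] [Fintype n]
  [DecidableEq n] {B : ι → Type*} [∀ j, Ring (B j)] [∀ j, Algebra F (B j)]

/-- The Kronecker product of a family of matrix representations, as a multilinear map. -/
def kroneckerMultilinear (ψ : ∀ j, B j →ₐ[F] Matrix n n K) :
    MultilinearMap F B (Matrix (ι → n) (ι → n) K) :=
  let entry (i k : ι → n) : MultilinearMap F B K :=
    (MultilinearMap.mkPiAlgebra F ι K).compLinearMap fun j =>
      (Matrix.entryLinearMap F K (i j) (k j)).comp (ψ j).toLinearMap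
  { toFun b := Matrix.of fun i k => ∏ j, ψ j (b j) (i j) (k j)
    map_update_add' b j s t := Matrix.ext fun i k => (entry i k).map_update_add b j s t
    map_update_smul' b j s t := Matrix.ext fun i k => (entry i k).map_update_smul b j s t }

theorem kroneckerMultilinear_apply (ψ : ∀ j, B j →ₐ[F] Matrix n n K) (b : ∀ j, B j)
    (i k : ι → n) : kroneckerMultilinear ψ b i k = ∏ j, ψ j (b j) (i j) (k j) := rfl

variable [DecidableEq ι]

/-- The representation of a tensor product of algebras given by Kronecker products of matrices. -/
noncomputable def kroneckerHom (ψ : ∀ j, B j →ₐ[F] Matrix n n K) :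
    (⨂[F] j, B j) →ₐ[F] Matrix (ι → n) (ι → n) K :=
  PiTensorProduct.liftAlgHom (kroneckerMultilinear ψ)
    (by
      ext i k
      simp only [kroneckerMultilinear_apply, Pi.one_apply, map_one, Matrix.one_apply,
        Finset.prod_ite_zero, Finset.prod_const_one, Finset.mem_univ, forall_const, funext_iff])
    (by
      intro a b
      ext i k
      simp only [kroneckerMultilinear_apply, Pi.mul_apply, map_mul, Matrix.mul_apply,
        ← Finset.prod_mul_distrib]
      rw [Finset.prod_univ_sum, Fintype.piFinset_univ])

theorem kroneckerHom_tprod (ψ : ∀ j, B j →ₐ[F] Matrix n n K) (b : ∀ j, B j) (i k : ι → n) :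
    kroneckerHom ψ (PiTensorProduct.tprod F b) i k = ∏ j, ψ j (b j) (i j) (k j) := by
  rw [kroneckerHom, PiTensorProduct.liftAlgHom_apply, PiTensorProduct.lift.tprod,
    kroneckerMultilinear_apply]

end Kronecker

/-- A representation of an `F`-algebra by `p × p` matrices over `K` in which `x` acts diagonally
with distinct eigenvalues `g` and `y` as `η` times the cyclic shift, and whose source is spanned by
the monomials `x ^ a * y ^ b` with `a, b < p`. This is the case of one tensor factor of
`SymbolRep`. -/
structure CyclicRep (p : ℕ) [NeZero p] (F K B : Type*) [Field F] [Field K] [Algebra F K] [Ring B]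
    [Algebra F B] where
  toHom : B →ₐ[F] Matrix (ZMod p) (ZMod p) K
  x : B
  y : B
  span_pow_mul_pow : Submodule.span F
    (Set.range fun q : ZMod p × ZMod p => x ^ q.1.val * y ^ q.2.val) = ⊤
  g : ZMod p → K
  g_injective : Function.Injective g
  η : K
  η_ne_zero : η ≠ 0
  toHom_x : toHom x = Matrix.diagonal g
  toHom_y : toHom y = η • shiftMatrix p K

namespace CyclicRep

/-- The representation of a tensor product of algebras by Kronecker products of cyclic
representations of its factors. -/
noncomputable def toSymbolRep {p : ℕ} [NeZero p] {ι F K : Type*} [Fintype ι] [DecidableEq ι]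
    [Field F] [Field K] [Algebra F K] {B : ι → Type*} [∀ j, Ring (B j)] [∀ j, Algebra F (B j)]
    (C : ∀ j, CyclicRep p F K (B j)) : SymbolRep p ι F K (⨂[F] j, B j) where
  toHom := kroneckerHom fun j => (C j).toHom
  gen u := PiTensorProduct.tprod F fun j =>
    (C j).x ^ (u (Sum.inl j)).val * (C j).y ^ (u (Sum.inr j)).val
  span_gen := by
    rw [← PiTensorProduct.submodule_span_eq_top fun j => (C j).span_pow_mul_pow]
    let e : (ι ⊕ ι → ZMod p) ≃ (ι → ZMod p × ZMod p) :=
      (Equiv.sumArrowEquivProdArrow ι ι (ZMod p)).trans (Equiv.arrowProdEquivProdArrow _ _ _).symm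
    exact congrArg _ (e.surjective.range_comp fun q : ι → ZMod p × ZMod p =>
      PiTensorProduct.tprod F fun j => (C j).x ^ (q j).1.val * (C j).y ^ (q j).2.val)
  g j := (C j).g
  g_injective j := (C j).g_injective
  η j := (C j).η
  η_ne_zero j := (C j).η_ne_zero
  toHom_gen u i k := by
    simp only [kroneckerHom_tprod, map_mul, map_pow, toHom_x, toHom_y,
      diagonal_pow_mul_shiftMatrix_pow_apply, ZMod.natCast_zmod_val, Finset.prod_ite_zero,
      Finset.mem_univ, forall_const, funext_iff, Pi.add_apply, Function.comp_apply]

open Polynomial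

variable {p : ℕ} [NeZero p] {F : Type u} {K : Type*} [Field F] [Field K] [Algebra F K]

/-- The cyclic representation of an algebra presented by two generators `x` and `y`, given matrices
that satisfy the relations. -/
noncomputable def ofRel {r : FreeAlgebra F (Fin 2) → FreeAlgebra F (Fin 2) → Prop} {g : ZMod p → K}
    {η : K} (hg : Function.Injective g) (hη : η ≠ 0)
    (hr : ∀ ⦃a b⦄, r a b → FreeAlgebra.lift F ![Matrix.diagonal g, η • shiftMatrix p K] a =
      FreeAlgebra.lift F ![Matrix.diagonal g, η • shiftMatrix p K] b)
    {P Q f : F[X]} (hP : P.Monic) (hPp : P.natDegree = p) (hQ : Q.Monic) (hQp : Q.natDegree = p)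
    (hx : aeval (RingQuot.mkAlgHom F r (FreeAlgebra.ι F 0)) P = 0)
    (hy : aeval (RingQuot.mkAlgHom F r (FreeAlgebra.ι F 1)) Q = 0)
    (hyx : RingQuot.mkAlgHom F r (FreeAlgebra.ι F 1) * RingQuot.mkAlgHom F r (FreeAlgebra.ι F 0) =
      aeval (RingQuot.mkAlgHom F r (FreeAlgebra.ι F 0)) f *
        RingQuot.mkAlgHom F r (FreeAlgebra.ι F 1)) :
    CyclicRep p F K (RingQuot r) where
  toHom := RingQuot.liftAlgHom F ⟨_, hr⟩
  x := RingQuot.mkAlgHom F r (FreeAlgebra.ι F 0)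
  y := RingQuot.mkAlgHom F r (FreeAlgebra.ι F 1)
  span_pow_mul_pow := by
    rw [eq_top_iff, ← span_pow_mul_pow_eq_top hP hx hQ hy (adjoin_mkAlgHom_ι_eq_top r) hyx]
    refine Submodule.span_mono (Set.range_subset_iff.2 fun q => ⟨(q.1, q.2), ?_⟩)
    simp only [ZMod.val_cast_of_lt (q.1.2.trans_eq hPp), ZMod.val_cast_of_lt (q.2.2.trans_eq hQp)]
  g := g
  g_injective := hg
  η := η
  η_ne_zero := hη
  toHom_x := by rw [RingQuot.liftAlgHom_mkAlgHom_apply]; simp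
  toHom_y := by rw [RingQuot.liftAlgHom_mkAlgHom_apply]; simp

theorem lift_eq_lift_of_symbolRel {ρ α β : F} {ξ η : K} (hξ : ξ ^ p = algebraMap F K α)
    (hη : η ^ p = algebraMap F K β) {χ : AddChar (ZMod p) K} (hχρ : χ 1 = algebraMap F K ρ)
    ⦃a b : FreeAlgebra F (Fin 2)⦄ (hab : SymbolRel p ρ α β a b) :
    FreeAlgebra.lift F ![Matrix.diagonal fun i => ξ * χ i, η • shiftMatrix p K] a =
      FreeAlgebra.lift F ![Matrix.diagonal fun i => ξ * χ i, η • shiftMatrix p K] b := by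
  rcases hab with _ | _ | _
  · simp [Matrix.diagonal_pow, Matrix.algebraMap_eq_diagonal, mul_pow, hξ,
      ← AddChar.map_nsmul_eq_pow]
  · simp [smul_shiftMatrix_pow_self, hη, IsScalarTower.algebraMap_apply F K (Matrix _ _ K)]
  · rw [map_mul, map_smul, map_mul, FreeAlgebra.lift_ι_apply, FreeAlgebra.lift_ι_apply]
    change η • shiftMatrix p K * Matrix.diagonal _ =
      ρ • (Matrix.diagonal _ * η • shiftMatrix p K)
    rw [smul_shiftMatrix_mul_diagonal, ← smul_mul_assoc ρ, ← Matrix.diagonal_smul]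
    congr 2
    funext i
    rw [AddChar.map_add_eq_mul, hχρ, Pi.smul_apply, Algebra.smul_def]
    ring

variable (p) in
/-- The representation of a symbol algebra given by roots of `α` and `β`. -/
noncomputable def symbolAlgebra {ρ α β : F} {ξ η : K} (hξ : ξ ^ p = algebraMap F K α)
    (hη : η ^ p = algebraMap F K β) (hξ₀ : ξ ≠ 0) (hη₀ : η ≠ 0) {χ : AddChar (ZMod p) K}
    (hχ : Function.Injective χ) (hχρ : χ 1 = algebraMap F K ρ) :
    CyclicRep p F K (SymbolAlgebra p ρ α β) :=
  ofRel (g := fun i => ξ * χ i) (η := η) (P := X ^ p - C α) (Q := X ^ p - C β) (f := C ρ * X)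
    ((mul_right_injective₀ hξ₀).comp hχ) hη₀
    (lift_eq_lift_of_symbolRel hξ hη hχρ)
    (monic_X_pow_sub_C α (NeZero.ne p)) natDegree_X_pow_sub_C (monic_X_pow_sub_C β (NeZero.ne p))
    natDegree_X_pow_sub_C
    (by
      rw [map_sub, aeval_X_pow, aeval_C, ← map_pow, RingQuot.mkAlgHom_rel F SymbolRel.x_pow,
        AlgHom.commutes, sub_self])
    (by
      rw [map_sub, aeval_X_pow, aeval_C, ← map_pow, RingQuot.mkAlgHom_rel F SymbolRel.y_pow,
        AlgHom.commutes, sub_self])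
    (by
      rw [← map_mul, RingQuot.mkAlgHom_rel F SymbolRel.comm, map_smul, map_mul, map_mul, aeval_C,
        aeval_X, ← Algebra.smul_def, smul_mul_assoc])

theorem lift_eq_lift_of_symbolRelCharP [Fact p.Prime] [CharP K p] {α β : F} {ξ η : K}
    (hξ : ξ ^ p - ξ = algebraMap F K α) (hη : η ^ p = algebraMap F K β)
    ⦃a b : FreeAlgebra F (Fin 2)⦄ (hab : SymbolRelCharP p α β a b) :
    FreeAlgebra.lift F
        ![Matrix.diagonal fun i => ξ + ZMod.castHom dvd_rfl K i, η • shiftMatrix p K] a =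
      FreeAlgebra.lift F
        ![Matrix.diagonal fun i => ξ + ZMod.castHom dvd_rfl K i, η • shiftMatrix p K] b := by
  rcases hab with _ | _ | _
  · rw [map_sub, map_pow, FreeAlgebra.lift_ι_apply, AlgHom.commutes]
    change Matrix.diagonal _ ^ p - Matrix.diagonal _ = _
    rw [Matrix.diagonal_pow, Matrix.diagonal_sub, Matrix.algebraMap_eq_diagonal]
    congr 1
    funext i
    rw [Pi.pow_apply, add_pow_char, ← map_pow, ZMod.pow_card, add_sub_add_right_eq_sub, hξ]
    rfl
  · simp [smul_shiftMatrix_pow_self, hη, IsScalarTower.algebraMap_apply F K (Matrix _ _ K)]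
  · rw [map_mul, map_mul, map_add, map_one, FreeAlgebra.lift_ι_apply, FreeAlgebra.lift_ι_apply]
    change η • shiftMatrix p K * Matrix.diagonal _ =
      (Matrix.diagonal _ + 1) * η • shiftMatrix p K
    rw [smul_shiftMatrix_mul_diagonal, ← Matrix.diagonal_one, Matrix.diagonal_add]
    congr 2
    funext i
    rw [map_add, map_one, add_assoc]

variable (p) in
/-- The representation of a symbol algebra in characteristic `p` given by roots of `X ^ p - X - α`
and `X ^ p - β`. -/
noncomputable def symbolAlgebraCharP [Fact p.Prime] [CharP K p] {α β : F} {ξ η : K}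
    (hξ : ξ ^ p - ξ = algebraMap F K α) (hη : η ^ p = algebraMap F K β) (hη₀ : η ≠ 0) :
    CyclicRep p F K (SymbolAlgebraCharP p α β) :=
  have hdeg : (X + C α).degree < (p : WithBot ℕ) := by
    rw [degree_X_add_C]
    exact_mod_cast (Fact.out : p.Prime).one_lt
  ofRel (g := fun i => ξ + ZMod.castHom dvd_rfl K i) (η := η) (P := X ^ p - (X + C α))
    (Q := X ^ p - C β) (f := X + 1)
    ((add_right_injective ξ).comp (ZMod.castHom dvd_rfl K).injective) hη₀
    (lift_eq_lift_of_symbolRelCharP hξ hη)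
    (monic_X_pow_sub hdeg) (natDegree_eq_of_degree_eq_some
      ((degree_sub_eq_left_of_degree_lt (hdeg.trans_eq (degree_X_pow (R := F) p).symm)).trans
        (degree_X_pow p)))
    (monic_X_pow_sub_C β (NeZero.ne p)) natDegree_X_pow_sub_C
    (by
      have hrel := RingQuot.mkAlgHom_rel F (SymbolRelCharP.x_pow (p := p) (α := α) (β := β))
      rw [map_sub, map_pow, AlgHom.commutes] at hrel
      rw [map_sub, map_add, aeval_X_pow, aeval_X, aeval_C, ← hrel, add_sub_cancel, sub_self])
    (by
      rw [map_sub, aeval_X_pow, aeval_C, ← map_pow, RingQuot.mkAlgHom_rel F SymbolRelCharP.y_pow,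
        AlgHom.commutes, sub_self])
    (by
      rw [← map_mul, RingQuot.mkAlgHom_rel F SymbolRelCharP.comm, map_mul, map_add, map_one,
        map_add, aeval_X, map_one])

end CyclicRep

section EigenvalueSums

variable {K : Type*} [Field K] {p : ℕ} [Fact p.Prime]

theorem sum_mul_addChar_pow (ξ : K) {χ : AddChar (ZMod p) K} (hχ : χ ≠ 1) (a : ZMod p) :
    ∑ i, (ξ * χ i) ^ a.val = if a = 0 then (p : K) else 0 := by
  split_ifs with h
  · simp [h]
  · have hperm : ∑ i, χ i ^ a.val = ∑ i, χ i := by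
      rw [← Equiv.sum_comp (Equiv.mulLeft₀ a h) χ]
      refine Finset.sum_congr rfl fun i _ => ?_
      rw [← AddChar.map_nsmul_eq_pow, nsmul_eq_mul, ZMod.natCast_zmod_val]
      rfl
    simp only [mul_pow, ← Finset.mul_sum]
    rw [hperm, AddChar.sum_eq_zero_of_ne_one hχ, mul_zero]

theorem sum_castHom_pow [CharP K p] {k : ℕ} (hk : k < p) :
    ∑ i, ZMod.castHom dvd_rfl K i ^ k = if k = p - 1 then -1 else 0 := by
  have hsum : ∑ i : ZMod p, i ^ k = if k = p - 1 then -1 else 0 := by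
    split_ifs with h
    · have hpow (i : ZMod p) : i ^ k = 1 - if i = 0 then 1 else 0 := by
        split_ifs with hi
        · rw [hi, zero_pow (h ▸ (Nat.sub_pos_of_lt (Fact.out : p.Prime).one_lt).ne'), sub_self]
        · rw [h, ZMod.pow_card_sub_one_eq_one hi, sub_zero]
      simp [hpow]
    · exact FiniteField.sum_pow_lt_card_sub_one (ZMod p) k (by rw [ZMod.card]; omega)
  simp only [← map_pow]
  rw [← map_sum, hsum]
  split_ifs <;> simp

theorem sum_add_castHom_pow [CharP K p] (ξ : K) (a : ZMod p) :
    ∑ i, (ξ + ZMod.castHom dvd_rfl K i) ^ a.val = if a = -1 then -1 else 0 := by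
  have hpos := (Fact.out : p.Prime).pos
  have hval : a.val = p - 1 ↔ a = -1 := by
    obtain ⟨q, rfl⟩ : ∃ q, p = q + 1 := ⟨p - 1, (Nat.sub_add_cancel hpos).symm⟩
    have hneg : (-1 : ZMod (q + 1)).val = q := ZMod.val_neg_one q
    exact ⟨fun h => ZMod.val_injective _ (h.trans hneg.symm), fun h => h ▸ hneg⟩
  have hbinomial : ∑ i, (ξ + ZMod.castHom dvd_rfl K i) ^ a.val =
      ∑ k ∈ Finset.range (a.val + 1), ξ ^ (a.val - k) * a.val.choose k *
        ∑ i, ZMod.castHom dvd_rfl K i ^ k := by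
    simp only [add_comm ξ, add_pow, Finset.mul_sum]
    rw [Finset.sum_comm]
    exact Finset.sum_congr rfl fun k _ => Finset.sum_congr rfl fun i _ => by ring
  have hlt : a.val < p := ZMod.val_lt a
  rw [hbinomial, Finset.sum_range_succ, Finset.sum_eq_zero fun k hk => ?_, zero_add,
    sum_castHom_pow hlt]
  · simp [hval]
  · rw [Finset.mem_range] at hk
    rw [sum_castHom_pow (hk.trans hlt), if_neg (by omega), mul_zero]

end EigenvalueSums

section IndependentValues

variable {F Γ : Type*} [Field F] [LinearOrderedCommGroupWithZero Γ] {κ κ' : Type*} [Fintype κ]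
  [Fintype κ']

/-- The values of the family `s` are independent modulo `q` in the value group of `ν`. For `q = 0`
this is independence over `ℤ`. -/
structure HasIndependentValues (ν : Valuation F Γ) (q : ℕ) (s : κ → F) : Prop where
  ne_zero : ∀ k, s k ≠ 0
  dvd : ∀ (f : F) (n : κ → ℤ), ν (f ^ q * ∏ k, s k ^ n k) = 1 → ∀ k, (q : ℤ) ∣ n k

namespace HasIndependentValues

variable {ν : Valuation F Γ} {q : ℕ} {s : κ → F}

theorem comp_injective (h : HasIndependentValues ν q s) {e : κ' → κ} (he : Function.Injective e) :
    HasIndependentValues ν q (s ∘ e) where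
  ne_zero k := h.ne_zero (e k)
  dvd f n hn k := by
    have hprod : ∏ k, (s ∘ e) k ^ n k = ∏ k, s k ^ Function.extend e n 0 k :=
      Fintype.prod_of_injective e he _ _
        (fun k hk => by rw [Function.extend_apply' _ _ _ hk, Pi.zero_apply, zpow_zero])
        (fun k => by rw [he.extend_apply, Function.comp_apply])
    rw [hprod] at hn
    simpa only [he.extend_apply] using h.dvd f _ hn (e k)

theorem comap {L : Type*} [Field L] {w : Valuation L Γ} (φ : F →+* L)
    (h : HasIndependentValues w q (φ ∘ s)) : HasIndependentValues (w.comap φ) q s where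
  ne_zero k := fun hk => h.ne_zero k (by rw [Function.comp_apply, hk, map_zero])
  dvd f n hn := h.dvd (φ f) n (by simpa [Valuation.comap_apply] using hn)

theorem dvd_of_valuation_pow_eq {K Γ' : Type*} [Field K] [Algebra F K]
    [LinearOrderedCommGroupWithZero Γ'] {w : Valuation K Γ'} [ν.HasExtension w] {t : κ → K}
    (h : HasIndependentValues ν q s) (ht : ∀ k, w (t k) ^ q = w (algebraMap F K (s k))) (f : F)
    (n : κ → ℤ) (hn : w (algebraMap F K f * ∏ k, t k ^ n k) = 1) (k : κ) : (q : ℤ) ∣ n k := by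
  refine h.dvd f n ((Valuation.HasExtension.val_map_eq_one_iff ν w _).1 ?_) k
  rw [← one_pow q, ← hn]
  simp only [map_mul, map_pow, map_prod, map_zpow₀, ← ht, mul_pow, ← Finset.prod_pow]
  simp only [← zpow_natCast, zpow_comm _ (q : ℤ)]

theorem eq_of_valuation_prod_pow_eq (h : HasIndependentValues ν 0 s) {d d' : κ → ℕ}
    (hd : ν (∏ k, s k ^ d k) = ν (∏ k, s k ^ d' k)) : d = d' := by
  have hprod : ∏ k, s k ^ (d k - d' k : ℤ) = (∏ k, s k ^ d k) / ∏ k, s k ^ d' k := by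
    simp only [zpow_sub₀ (h.ne_zero _), zpow_natCast, Finset.prod_div_distrib]
  have hne : ν (∏ k, s k ^ d' k) ≠ 0 :=
    ν.ne_zero_iff.2 (Finset.prod_ne_zero_iff.2 fun k _ => pow_ne_zero _ (h.ne_zero k))
  funext k
  have hdvd := h.dvd 1 _ (by rw [one_pow, one_mul, hprod, map_div₀, hd, div_self hne]) k
  rwa [Nat.cast_zero, zero_dvd_iff, sub_eq_zero, Nat.cast_inj] at hdvd

theorem algebraicIndependent {F₀ : Type*} [Field F₀] [Algebra F₀ F] [ν.IsTrivialOn F₀]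
    (h : HasIndependentValues ν 0 s) : AlgebraicIndependent F₀ s := by
  refine (injective_iff_map_eq_zero _).2 fun P hP => ?_
  by_contra hne
  let monomial (d : κ →₀ ℕ) : F := ∏ k, s k ^ d k
  have hterm {d} (hd : d ∈ P.support) :
      ν (algebraMap F₀ F (P.coeff d) * monomial d) = ν (monomial d) := by
    rw [map_mul, Valuation.IsTrivialOn.eq_one _ (MvPolynomial.mem_support_iff.1 hd), one_mul]
  obtain ⟨d, hd, hmax⟩ := P.support.exists_max_image (fun d => ν (monomial d))
    (MvPolynomial.support_nonempty.2 hne)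
  have hsum : ν (MvPolynomial.aeval s P) = ν (monomial d) := by
    classical
    rw [MvPolynomial.aeval_def, MvPolynomial.eval₂_eq', ← hterm hd]
    refine ν.map_sum_eq_of_lt hd fun d' hd' => ?_
    rw [Finset.mem_sdiff, Finset.mem_singleton] at hd'
    rw [hterm hd, hterm hd'.1]
    exact (hmax d' hd'.1).lt_of_ne fun heq =>
      hd'.2 (DFunLike.coe_injective (h.eq_of_valuation_prod_pow_eq heq))
  rw [hP, map_zero, eq_comm, ν.zero_iff] at hsum
  exact Finset.prod_ne_zero_iff.2 (fun k _ => pow_ne_zero _ (h.ne_zero k)) hsum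

end HasIndependentValues

theorem exists_valuationSubring_hasExtension {K : Type*} [Field K] [Algebra F K]
    (ν : Valuation F Γ) : ∃ 𝒪 : ValuationSubring K, ν.HasExtension 𝒪.valuation := by
  obtain ⟨𝒪, hle, hloc⟩ := IsLocalRing.exists_factor_valuationRing
    ((algebraMap F K).comp ν.valuationSubring.subtype)
  refine ⟨𝒪, ⟨Valuation.isEquiv_iff_val_le_one.2 fun {x} => ?_⟩⟩
  rw [Valuation.comap_apply, 𝒪.valuation_le_one_iff]
  refine ⟨fun hx => hle ⟨x, hx⟩, fun hx => not_lt.1 fun hlt => ?_⟩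
  have hx₀ : x ≠ 0 := fun h => by simp [h] at hlt
  have hinv : ν x⁻¹ < 1 := by rwa [map_inv₀, inv_lt_one₀ (zero_lt_one.trans hlt)]
  have hunit : IsUnit (⟨x⁻¹, hinv.le⟩ : ν.valuationSubring) := by
    refine hloc.map_nonunit _ (IsUnit.of_mul_eq_one ⟨algebraMap F K x, hx⟩ (Subtype.ext ?_))
    change algebraMap F K x⁻¹ * algebraMap F K x = 1
    rw [← map_mul, inv_mul_cancel₀ hx₀, map_one]
  rw [ValuationSubring.valuation_eq_one_iff,
    ← (Valuation.isEquiv_valuation_valuationSubring ν).eq_one_iff_eq_one] at hunit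
  exact hinv.ne hunit

end IndependentValues

section LaurentSeries

open HahnSeries (C single)

variable {K : Type*} [Field K]

theorem mem_and_inv_mem_iff_valuation_eq_one (𝒪 : ValuationSubring K) {x : K} (hx : x ≠ 0) :
    x ∈ 𝒪 ∧ x⁻¹ ∈ 𝒪 ↔ 𝒪.valuation x = 1 := by
  rw [← 𝒪.valuation_le_one_iff, ← 𝒪.valuation_le_one_iff, map_inv₀,
    inv_le_one₀ (zero_lt_iff.2 (𝒪.valuation.ne_zero_iff.2 hx)), le_antisymm_iff]

theorem laurentSeries_order_inv {x : LaurentSeries K} (hx : x ≠ 0) : x⁻¹.order = -x.order := by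
  rw [eq_neg_iff_add_eq_zero, ← HahnSeries.order_mul (inv_ne_zero hx) hx, inv_mul_cancel₀ hx,
    HahnSeries.order_one]

/-- The leading coefficient of a Laurent series as a multiplicative map. -/
noncomputable def leadingCoeffHom (K : Type*) [Field K] : LaurentSeries K →*₀ K where
  toFun := HahnSeries.leadingCoeff
  map_zero' := HahnSeries.leadingCoeff_zero
  map_one' := HahnSeries.leadingCoeff_one
  map_mul' x y := HahnSeries.leadingCoeff_mul x y

theorem laurentSeries_leadingCoeff_inv (x : LaurentSeries K) :
    x⁻¹.leadingCoeff = x.leadingCoeff⁻¹ :=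
  map_inv₀ (leadingCoeffHom K) x

theorem laurentSeries_leadingCoeff_pow (x : LaurentSeries K) (n : ℕ) :
    (x ^ n).leadingCoeff = x.leadingCoeff ^ n :=
  map_pow (leadingCoeffHom K) x n

theorem coeff_zero_mem_iff_order (𝒪 : ValuationSubring K) (x : LaurentSeries K) :
    ((∀ n < 0, x.coeff n = 0) ∧ x.coeff 0 ∈ 𝒪) ↔
      x = 0 ∨ 0 < x.order ∨ x.order = 0 ∧ x.leadingCoeff ∈ 𝒪 := by
  rcases eq_or_ne x 0 with rfl | hx
  · simp [𝒪.zero_mem]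
  have hneg : (∀ n < 0, x.coeff n = 0) ↔ 0 ≤ x.order :=
    ⟨fun h => not_lt.1 fun hlt => HahnSeries.coeff_order_eq_zero.not.2 hx (h _ hlt),
      fun h n hn => HahnSeries.coeff_eq_zero_of_lt_order (hn.trans_le h)⟩
  rw [hneg, or_iff_right hx, le_iff_lt_or_eq, or_and_right]
  refine or_congr ⟨And.left, fun h => ⟨h, ?_⟩⟩
    ⟨fun ⟨h, h'⟩ => ⟨h.symm, ?_⟩, fun ⟨h, h'⟩ => ⟨h.symm, ?_⟩⟩
  · rw [HahnSeries.coeff_eq_zero_of_lt_order h]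
    exact 𝒪.zero_mem
  · rwa [HahnSeries.leadingCoeff_eq, ← h]
  · rwa [HahnSeries.leadingCoeff_eq, h] at h'

/-- The valuation ring of the composite of the order valuation on Laurent series with the valuation
of the coefficient field given by `𝒪`. -/
def compositeSubring (𝒪 : ValuationSubring K) : ValuationSubring (LaurentSeries K) where
  carrier := {x | (∀ n < 0, x.coeff n = 0) ∧ x.coeff 0 ∈ 𝒪}
  zero_mem' := ⟨fun _ _ => rfl, 𝒪.zero_mem⟩
  one_mem' := (coeff_zero_mem_iff_order 𝒪 1).2 (Or.inr (Or.inr (by simp [𝒪.one_mem])))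
  add_mem' {x y} hx hy :=
    ⟨fun n hn => by simp [hx.1 n hn, hy.1 n hn], 𝒪.add_mem _ _ hx.2 hy.2⟩
  neg_mem' {x} hx := ⟨fun n hn => by simp [hx.1 n hn], 𝒪.neg_mem _ hx.2⟩
  mul_mem' {x y} hx hy := by
    refine (coeff_zero_mem_iff_order 𝒪 _).2 ((eq_or_ne (x * y) 0).imp_right fun hxy => ?_)
    rw [HahnSeries.order_mul (left_ne_zero_of_mul hxy) (right_ne_zero_of_mul hxy),
      HahnSeries.leadingCoeff_mul]
    rcases ((coeff_zero_mem_iff_order 𝒪 x).1 hx).resolve_left (left_ne_zero_of_mul hxy) with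
      h | ⟨h, hx⟩ <;>
    rcases ((coeff_zero_mem_iff_order 𝒪 y).1 hy).resolve_left (right_ne_zero_of_mul hxy) with
      h' | ⟨h', hy⟩
    · exact Or.inl (by omega)
    · exact Or.inl (by omega)
    · exact Or.inl (by omega)
    · exact Or.inr ⟨by omega, 𝒪.mul_mem _ _ hx hy⟩
  mem_or_inv_mem' x := by
    rcases eq_or_ne x 0 with rfl | hx
    · exact Or.inl ⟨fun _ _ => rfl, 𝒪.zero_mem⟩
    refine ((coeff_zero_mem_iff_order 𝒪 x).or (coeff_zero_mem_iff_order 𝒪 x⁻¹)).2 ?_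
    rw [laurentSeries_order_inv hx, laurentSeries_leadingCoeff_inv]
    rcases lt_trichotomy x.order 0 with h | h | h
    · exact Or.inr (Or.inr (Or.inl (neg_pos.2 h)))
    · exact (𝒪.mem_or_inv_mem x.leadingCoeff).imp (fun h' => Or.inr (Or.inr ⟨h, h'⟩))
        fun h' => Or.inr (Or.inr ⟨neg_eq_zero.2 h, h'⟩)
    · exact Or.inl (Or.inr (Or.inl h))

variable {𝒪 : ValuationSubring K}

theorem mem_compositeSubring_iff {x : LaurentSeries K} (hx : x ≠ 0) :
    x ∈ compositeSubring 𝒪 ↔ 0 < x.order ∨ x.order = 0 ∧ x.leadingCoeff ∈ 𝒪 :=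
  (coeff_zero_mem_iff_order 𝒪 x).trans (or_iff_right hx)

theorem valuation_compositeSubring_eq_one_iff {x : LaurentSeries K} :
    (compositeSubring 𝒪).valuation x = 1 ↔ x.order = 0 ∧ 𝒪.valuation x.leadingCoeff = 1 := by
  rcases eq_or_ne x 0 with rfl | hx
  · simp
  rw [← mem_and_inv_mem_iff_valuation_eq_one _ hx, mem_compositeSubring_iff hx,
    mem_compositeSubring_iff (inv_ne_zero hx), laurentSeries_order_inv hx,
    laurentSeries_leadingCoeff_inv,
    ← mem_and_inv_mem_iff_valuation_eq_one _ (HahnSeries.leadingCoeff_ne_zero.2 hx), neg_pos,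
    neg_eq_zero]
  grind

theorem C_mem_compositeSubring_iff {c : K} : C c ∈ compositeSubring 𝒪 ↔ c ∈ 𝒪 := by
  rcases eq_or_ne c 0 with rfl | hc
  · simp [zero_mem]
  · rw [mem_compositeSubring_iff (HahnSeries.C_ne_zero hc), HahnSeries.order_C, HahnSeries.C_apply,
      HahnSeries.leadingCoeff_of_single]
    simp

theorem one_lt_valuation_single {n : ℤ} (hn : n < 0) :
    1 < (compositeSubring 𝒪).valuation (single n 1) := by
  rw [← not_le, ValuationSubring.valuation_le_one_iff,
    mem_compositeSubring_iff (HahnSeries.single_ne_zero one_ne_zero),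
    HahnSeries.order_single one_ne_zero]
  omega

theorem valuation_compositeSubring_C_eq_one_iff {c : K} :
    (compositeSubring 𝒪).valuation (C c) = 1 ↔ 𝒪.valuation c = 1 := by
  rw [valuation_compositeSubring_eq_one_iff, HahnSeries.order_C, HahnSeries.C_apply,
    HahnSeries.leadingCoeff_of_single, eq_self_iff_true, true_and]

theorem one_lt_valuation_compositeSubring_C_iff {c : K} :
    1 < (compositeSubring 𝒪).valuation (C c) ↔ 1 < 𝒪.valuation c := by
  rw [← not_le, ← not_le, ValuationSubring.valuation_le_one_iff,
    ValuationSubring.valuation_le_one_iff, C_mem_compositeSubring_iff]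

theorem HasIndependentValues.compositeSubring {κ : Type*} [Fintype κ] {q : ℕ} {s : κ → K}
    (h : HasIndependentValues 𝒪.valuation q s) :
    HasIndependentValues (compositeSubring 𝒪).valuation q
      (fun k : Option κ => k.elim (single (-1) 1) fun k => C (s k)) where
  ne_zero k := by
    cases k with
    | none => exact HahnSeries.single_ne_zero one_ne_zero
    | some k => exact HahnSeries.C_ne_zero (h.ne_zero k)
  dvd f n hn := by
    have hprod : ∏ k : Option κ, k.elim (single (-1) 1) (fun k => C (s k)) ^ n k =
        single (-n none) 1 * C (∏ k, s k ^ n (some k)) := by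
      rw [Fintype.prod_option, Option.elim_none, RatFunc.single_zpow (-n none),
        RatFunc.single_zpow (-1), ← zpow_mul, neg_one_mul, map_prod]
      simp only [Option.elim_some, map_zpow₀]
    rw [hprod] at hn
    have hne := (ValuationSubring.valuation _).ne_zero_iff.1 (hn.trans_ne one_ne_zero)
    obtain ⟨horder, hlead⟩ := valuation_compositeSubring_eq_one_iff.1 hn
    rw [HahnSeries.order_mul (left_ne_zero_of_mul hne) (right_ne_zero_of_mul hne),
      HahnSeries.order_mul (left_ne_zero_of_mul (right_ne_zero_of_mul hne))
        (right_ne_zero_of_mul (right_ne_zero_of_mul hne)), HahnSeries.order_pow,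
      HahnSeries.order_single one_ne_zero, HahnSeries.order_C, nsmul_eq_mul] at horder
    rw [HahnSeries.leadingCoeff_mul, HahnSeries.leadingCoeff_mul, laurentSeries_leadingCoeff_pow,
      HahnSeries.leadingCoeff_of_single, one_mul, HahnSeries.C_apply,
      HahnSeries.leadingCoeff_of_single] at hlead
    rintro (_ | k)
    · exact ⟨f.order, by omega⟩
    · exact h.dvd f.leadingCoeff (fun k => n (some k)) hlead k

end LaurentSeries

namespace SlotField

open HahnSeries (C single)

variable {F₀ : Type u} [Field F₀] {m : ℕ}

/-- A valuation, trivial on the constants, at which every `α j` is large and the slots have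
independent values modulo every `q`. In characteristic `p`, the largeness of `α j` makes the roots
`ξ + i` of `X ^ p - X - α j` share their leading term. -/
structure IsAdapted (F : SlotField F₀ m) {Γ : Type*} [LinearOrderedCommGroupWithZero Γ]
    (ν : Valuation F Γ) : Prop where
  isTrivialOn : ν.IsTrivialOn F₀
  one_lt_α : ∀ j, 1 < ν (F.α j)
  hasIndependentValues : ∀ q, HasIndependentValues ν q (Sum.elim F.α F.β)

/-- One step of the construction of `SlotField.laurent`. -/
noncomputable abbrev adjoinLaurent (F : SlotField F₀ m) : SlotField F₀ (m + 1) where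
  carrier := LaurentSeries (LaurentSeries F)
  α := Fin.snoc (α := fun _ => LaurentSeries (LaurentSeries F)) (fun i => C (C (F.α i)))
    (C (single (-1) 1))
  β := Fin.snoc (α := fun _ => LaurentSeries (LaurentSeries F)) (fun i => C (C (F.β i)))
    (single (-1) 1)

theorem sumElim_adjoinLaurent (F : SlotField F₀ m) :
    Sum.elim F.adjoinLaurent.α F.adjoinLaurent.β =
      (fun k : Option (Option (Fin m ⊕ Fin m)) => k.elim (single (-1) 1) fun k =>
        C (k.elim (single (-1) 1) fun k => C (Sum.elim F.α F.β k))) ∘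
      Sum.elim (some ∘ Option.map Sum.inl ∘ finSuccEquivLast)
        (Option.map (some ∘ Sum.inr) ∘ finSuccEquivLast) := by
  funext k
  rcases k with k | k <;> cases k using Fin.lastCases <;> simp [adjoinLaurent]

theorem hasIndependentValues_adjoinLaurent {F : SlotField F₀ m} {𝒪 : ValuationSubring F} {q : ℕ}
    (h : HasIndependentValues 𝒪.valuation q (Sum.elim F.α F.β)) :
    HasIndependentValues (compositeSubring (compositeSubring 𝒪)).valuation q
      (Sum.elim F.adjoinLaurent.α F.adjoinLaurent.β) := by
  rw [sumElim_adjoinLaurent]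
  refine h.compositeSubring.compositeSubring.comp_injective
    (Function.Injective.sumElim ?_ ?_ fun i j => ?_)
  · exact (Option.some_injective _).comp
      ((Option.map_injective Sum.inl_injective).comp finSuccEquivLast.injective)
  · exact (Option.map_injective ((Option.some_injective _).comp Sum.inr_injective)).comp
      finSuccEquivLast.injective
  · cases i using Fin.lastCases <;> cases j using Fin.lastCases <;> simp

theorem IsAdapted.adjoinLaurent {F : SlotField F₀ m} {𝒪 : ValuationSubring F}
    (h : F.IsAdapted 𝒪.valuation) :
    F.adjoinLaurent.IsAdapted (compositeSubring (compositeSubring 𝒪)).valuation where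
  isTrivialOn := ⟨fun c hc => by
    have hC : algebraMap F₀ (LaurentSeries (LaurentSeries F)) c = C (C (algebraMap F₀ F c)) := by
      simp only [HahnSeries.algebraMap_apply', PowerSeries.algebraMap_apply,
        HahnSeries.ofPowerSeries_C]
    exact (congrArg _ hC).trans (valuation_compositeSubring_C_eq_one_iff.2
      (valuation_compositeSubring_C_eq_one_iff.2 (h.isTrivialOn.eq_one c hc)))⟩
  one_lt_α j := by
    cases j using Fin.lastCases with
    | last =>
      simpa [SlotField.adjoinLaurent] using one_lt_valuation_compositeSubring_C_iff.2
        (one_lt_valuation_single (𝒪 := 𝒪) neg_one_lt_zero)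
    | cast j =>
      simpa [SlotField.adjoinLaurent] using one_lt_valuation_compositeSubring_C_iff.2
        (one_lt_valuation_compositeSubring_C_iff.2 (h.one_lt_α j))
  hasIndependentValues q := hasIndependentValues_adjoinLaurent (h.hasIndependentValues q)

theorem exists_isAdapted_laurent (F₀ : Type u) [Field F₀] (m : ℕ) :
    ∃ 𝒪 : ValuationSubring (laurent F₀ m), (laurent F₀ m).IsAdapted 𝒪.valuation := by
  induction m with
  | zero =>
    refine ⟨⊤, ⟨fun c hc => ?_⟩, fun j => j.elim0, fun q => ⟨?_, fun _ _ _ => ?_⟩⟩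
    · exact (mem_and_inv_mem_iff_valuation_eq_one _ ((map_ne_zero _).2 hc)).1 ⟨trivial, trivial⟩
    · exact Sum.rec (fun j => j.elim0) fun j => j.elim0
    · exact Sum.rec (fun j => j.elim0) fun j => j.elim0
  | succ m ih =>
    obtain ⟨𝒪, h⟩ := ih
    exact ⟨_, h.adjoinLaurent⟩

theorem exists_algHom_rational {L : Type*} [Field L] [Algebra F₀ L] {s : Fin m ⊕ Fin m → L}
    (hs : AlgebraicIndependent F₀ s) :
    ∃ φ : rational F₀ m →ₐ[F₀] L, φ ∘ Sum.elim (rational F₀ m).α (rational F₀ m).β = s := by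
  let φ : FractionRing (MvPolynomial (Fin m ⊕ Fin m) F₀) →ₐ[F₀] L :=
    IsFractionRing.liftAlgHom (g := MvPolynomial.aeval s) hs
  have hφ (k) : φ (algebraMap (MvPolynomial (Fin m ⊕ Fin m) F₀) _ (MvPolynomial.X k)) = s k :=
    (IsFractionRing.lift_algebraMap hs _).trans (MvPolynomial.aeval_X s k)
  refine ⟨φ, funext fun k => ?_⟩
  cases k <;> exact hφ _

theorem exists_isAdapted_rational (F₀ : Type u) [Field F₀] (m : ℕ) :
    ∃ (Γ : Type u) (_ : LinearOrderedCommGroupWithZero Γ) (ν : Valuation (rational F₀ m) Γ),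
      (rational F₀ m).IsAdapted ν := by
  obtain ⟨𝒪, h⟩ := exists_isAdapted_laurent F₀ m
  have : 𝒪.valuation.IsTrivialOn F₀ := h.isTrivialOn
  obtain ⟨φ, hφ⟩ :=
    exists_algHom_rational (F₀ := F₀) (h.hasIndependentValues 0).algebraicIndependent
  refine ⟨_, _, 𝒪.valuation.comap φ, ⟨fun c hc => ?_⟩, fun j => ?_, fun q => ?_⟩
  · rw [Valuation.comap_apply, RingHom.coe_coe, φ.commutes]
    exact Valuation.IsTrivialOn.eq_one c hc
  · exact (h.one_lt_α j).trans_eq (congrArg 𝒪.valuation (congrFun hφ (Sum.inl j))).symm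
  · exact HasIndependentValues.comap _ (hφ.symm ▸ h.hasIndependentValues q)

theorem exists_isAdapted {F : SlotField F₀ m} (hF : F = rational F₀ m ∨ F = laurent F₀ m) :
    ∃ (Γ : Type u) (_ : LinearOrderedCommGroupWithZero Γ) (ν : Valuation F Γ), F.IsAdapted ν := by
  rcases hF with rfl | rfl
  · exact exists_isAdapted_rational F₀ m
  · obtain ⟨𝒪, h⟩ := exists_isAdapted_laurent F₀ m
    exact ⟨_, _, 𝒪.valuation, h⟩

theorem IsAdapted.valuation_natCast {F : SlotField F₀ m} {Γ : Type*}
    [LinearOrderedCommGroupWithZero Γ] {ν : Valuation F Γ} (h : F.IsAdapted ν) {k : ℕ}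
    (hk : (k : F₀) ≠ 0) : ν (k : F) = 1 := by
  rw [← map_natCast (algebraMap F₀ F), h.isTrivialOn.eq_one _ hk]

end SlotField

theorem natCast_ne_zero_of_lt_ringChar {R : Type*} [NonAssocSemiring R] {p : ℕ}
    (hchar : ringChar R = 0 ∨ p ≤ ringChar R) {k : ℕ} (hk : 0 < k) (hkp : k < p) : (k : R) ≠ 0 := by
  rw [Ne, ringChar.spec]
  intro hdvd
  rcases hchar with h | h
  · rw [h, zero_dvd_iff] at hdvd
    exact hk.ne' hdvd
  · exact (hkp.trans_le h).not_ge (Nat.le_of_dvd hk hdvd)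

theorem SymbolRep.IsTame.rank_le_of_charCoeff_eq_zero {p : ℕ} [Fact p.Prime] {ι F A : Type*}
    [Fintype ι] [DecidableEq ι] [Field F] [Ring A] [Algebra F A]
    {R : SymbolRep p ι F (AlgebraicClosure F) A} {𝒪 : ValuationSubring (AlgebraicClosure F)}
    {ξ : ι → AlgebraicClosure F} {χ : AddChar (ZMod p) (IsLocalRing.ResidueField 𝒪)}
    (h : R.IsTame ξ χ)
    (hcast : ∀ k : ℕ, 0 < k → k < p → (k : IsLocalRing.ResidueField 𝒪) ≠ 0) {t : ZMod p} {θ : F}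
    (hθ : θ ≠ 0) (hsum : ∀ j (a : ZMod p),
      ∑ i, R.g j i ^ a.val = if a = t then algebraMap F (AlgebraicClosure F) θ else 0)
    (ht : χ = 1 ∨ t = 0) (V : Submodule F A)
    (hV : ∀ v ∈ V, ∀ i ∈ Finset.Icc 1 (p - 1), charCoeff F i v = 0) :
    Module.rank F V ≤ (((p ^ (2 * Fintype.card ι) - 1) / (p - 1) : ℕ) : Cardinal) := by
  have hp := (Fact.out : p.Prime).one_lt
  obtain ⟨φ, hφ⟩ := R.exists_algEquiv
  have htrace (v : A) (k : ℕ) : (φ (1 ⊗ₜ v) ^ k).trace = algebraMap F (AlgebraicClosure F)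
      (θ ^ Fintype.card ι * R.basis.repr (v ^ k) (Sum.elim (fun _ => t) 0)) := by
    rw [hφ, ← map_pow, R.trace_toHom hsum]
  refine h.rank_le hcast (t := Sum.elim (fun _ => t) 0) (ht.imp_right ?_) V fun v hv => ?_
  · rintro rfl
    funext k
    cases k <;> rfl
  · have hzero := trace_pow_eq_zero_of_charCoeff φ (Nat.sub_pos_of_lt hp).ne'
      (fun k hk hkp => natCast_ne_zero_of_residueField F (hcast k hk (by omega)))
      (fun k => ⟨_, (htrace v k).symm⟩) (hV v hv)
    rw [htrace, map_eq_zero] at hzero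
    exact (mul_eq_zero.1 hzero).resolve_left (pow_ne_zero _ hθ)

section Roots

variable {F K : Type*} [Field F] [Field K] [Algebra F K] [IsAlgClosed K] {p : ℕ}

theorem exists_pow_eq_algebraMap [NeZero p] {a : F} (ha : a ≠ 0) :
    ∃ z : K, z ≠ 0 ∧ z ^ p = algebraMap F K a := by
  obtain ⟨z, hz⟩ := IsAlgClosed.exists_pow_nat_eq (algebraMap F K a) (NeZero.pos p)
  refine ⟨z, fun hzero => (map_ne_zero (algebraMap F K)).2 ha ?_, hz⟩
  rw [← hz, hzero, zero_pow (NeZero.ne p)]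

open Polynomial in
theorem exists_pow_sub_self_eq (hp : 1 < p) (a : K) : ∃ z : K, z ^ p - z = a := by
  have hdeg : (X ^ p - (X + C a) : K[X]).degree = p := by
    rw [degree_sub_eq_left_of_degree_lt, degree_X_pow]
    rw [degree_X_add_C, degree_X_pow]
    exact_mod_cast hp
  obtain ⟨z, hz⟩ := IsAlgClosed.exists_root (X ^ p - (X + C a) : K[X]) (by
    rw [hdeg]
    exact_mod_cast (zero_lt_one.trans hp).ne')
  refine ⟨z, ?_⟩
  rwa [IsRoot.def, eval_sub, eval_pow, eval_add, eval_X, eval_C, sub_add_eq_sub_sub,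
    sub_eq_zero] at hz

end Roots

theorem one_lt_and_pow_eq_of_one_lt_pow_sub_self {K Γ : Type*} [Field K]
    [LinearOrderedCommGroupWithZero Γ] (ν : Valuation K Γ) {n : ℕ} (hn : 1 < n) {z : K}
    (hz : 1 < ν (z ^ n - z)) : 1 < ν z ∧ ν z ^ n = ν (z ^ n - z) := by
  have hlt : 1 < ν z := by
    contrapose! hz
    exact (ν.map_sub _ _).trans (max_le ((map_pow ν z n).trans_le (pow_le_one' hz n)) hz)
  refine ⟨hlt, ?_⟩
  rw [ν.map_sub_eq_of_lt_left, map_pow]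
  rw [map_pow]
  exact lt_self_pow₀ hlt hn

theorem exists_addChar_of_isPrimitiveRoot {K : Type*} [Field K] (𝒪 : ValuationSubring K) {n : ℕ}
    (hn : 1 < n) {ζ : K} (hζ : IsPrimitiveRoot ζ n) :
    ∃ χ : AddChar (ZMod n) 𝒪, Function.Injective χ ∧ (χ 1 : K) = ζ := by
  have : Fact (1 < n) := ⟨hn⟩
  have : NeZero n := ⟨(zero_lt_one.trans hn).ne'⟩
  have hζ𝒪 : ζ ∈ 𝒪 := by
    rw [← 𝒪.valuation_le_one_iff, ← pow_le_one_iff (NeZero.ne n), ← map_pow, hζ.pow_eq_one, map_one]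
  refine ⟨AddChar.zmodChar n (ζ := ⟨ζ, hζ𝒪⟩) (Subtype.ext hζ.pow_eq_one), fun a b hab => ?_, ?_⟩
  · exact ZMod.val_injective n (hζ.pow_inj (ZMod.val_lt a) (ZMod.val_lt b)
      (congrArg Subtype.val hab))
  · rw [AddChar.zmodChar_apply, ZMod.val_one, pow_one]

theorem exists_add_eq_mul {K : Type*} [Field K] {𝒪 : ValuationSubring K} {z c : K}
    (hz : 1 < 𝒪.valuation z) (hc : c ∈ 𝒪) :
    ∃ y : 𝒪, z + c = z * y ∧ IsLocalRing.residue 𝒪 y = 1 := by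
  have hz₀ : z ≠ 0 := (Valuation.ne_zero_iff _).1 (zero_lt_one.trans hz).ne'
  have hinv : 𝒪.valuation z⁻¹ < 1 := by
    rwa [map_inv₀, inv_lt_one₀ (zero_lt_one.trans hz)]
  let x : 𝒪 := ⟨z⁻¹, (𝒪.valuation_le_one_iff _).1 hinv.le⟩
  have hx : IsLocalRing.residue 𝒪 x = 0 := by
    rwa [IsLocalRing.residue_eq_zero_iff, 𝒪.valuation_lt_one_iff]
  refine ⟨1 + ⟨c, hc⟩ * x, ?_, by rw [map_add, map_one, map_mul, hx, mul_zero, add_zero]⟩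
  change z + c = z * (1 + c * z⁻¹)
  field_simp

section ValuedField

variable {F : Type u} {Γ ι : Type*} [Field F] [LinearOrderedCommGroupWithZero Γ]
  {ν : Valuation F Γ} [Fintype ι] {p : ℕ} [Fact p.Prime] {α β : ι → F}

theorem rank_le_of_symbolAlgebra (h : HasIndependentValues ν p (Sum.elim α β))
    (hcast : ∀ k : ℕ, 0 < k → k < p → ν (k : F) = 1) {ρ : F} (hρ : IsPrimitiveRoot ρ p)
    (V : Submodule F (⨂[F] j, SymbolAlgebra p ρ (α j) (β j)))
    (hV : ∀ v ∈ V, ∀ i ∈ Finset.Icc 1 (p - 1), charCoeff F i v = 0) :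
    Module.rank F V ≤ (((p ^ (2 * Fintype.card ι) - 1) / (p - 1) : ℕ) : Cardinal) := by
  classical
  let K := AlgebraicClosure F
  obtain ⟨𝒪, _⟩ := exists_valuationSubring_hasExtension (K := K) ν
  obtain ⟨χ, hχ, hχρ⟩ := exists_addChar_of_isPrimitiveRoot 𝒪 (Fact.out : p.Prime).one_lt
    (hρ.map_of_injective (algebraMap F K).injective)
  let χK : AddChar (ZMod p) K := 𝒪.subtype.toMonoidHom.compAddChar χ
  have hχK : Function.Injective χK := Subtype.val_injective.comp hχ
  choose ξ hξ₀ hξ using fun j => exists_pow_eq_algebraMap (K := K) (p := p) (h.ne_zero (Sum.inl j))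
  choose η hη₀ hη using fun j => exists_pow_eq_algebraMap (K := K) (p := p) (h.ne_zero (Sum.inr j))
  let R : SymbolRep p ι F K (⨂[F] j, SymbolAlgebra p ρ (α j) (β j)) :=
    CyclicRep.toSymbolRep fun j =>
      CyclicRep.symbolAlgebra p (hξ j) (hη j) (hξ₀ j) (hη₀ j) hχK hχρ
  have hR : R.IsTame ξ ((IsLocalRing.residue 𝒪).toMonoidHom.compAddChar χ) :=
    { ξ_ne_zero := hξ₀
      exists_g_eq := fun j i => ⟨χ i, rfl, rfl⟩
      independent := h.dvd_of_valuation_pow_eq <| Sum.rec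
        (fun j => (map_pow _ _ _).symm.trans (congrArg _ (hξ j)))
        fun j => (map_pow _ _ _).symm.trans (congrArg _ (hη j)) }
  refine hR.rank_le_of_charCoeff_eq_zero (fun k hk hkp => ?_) hρ.neZero'.ne (t := 0)
    (fun j a => ?_) (Or.inr rfl) V hV
  · rw [natCast_residueField_ne_zero_iff, ← map_natCast (algebraMap F K),
      Valuation.HasExtension.val_map_eq_one_iff ν, hcast k hk hkp]
  · have hχ₁ : χK ≠ 1 := fun h1 => one_ne_zero (hχK (a₁ := 1) (a₂ := 0) (by simp [h1]))
    rw [map_natCast]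
    exact sum_mul_addChar_pow (ξ j) hχ₁ a

theorem rank_le_of_symbolAlgebraCharP [CharP F p] (h : HasIndependentValues ν p (Sum.elim α β))
    (hα : ∀ j, 1 < ν (α j)) (V : Submodule F (⨂[F] j, SymbolAlgebraCharP p (α j) (β j)))
    (hV : ∀ v ∈ V, ∀ i ∈ Finset.Icc 1 (p - 1), charCoeff F i v = 0) :
    Module.rank F V ≤ (((p ^ (2 * Fintype.card ι) - 1) / (p - 1) : ℕ) : Cardinal) := by
  classical
  have hp := (Fact.out : p.Prime).one_lt
  let K := AlgebraicClosure F
  have : CharP K p := charP_of_injective_algebraMap (algebraMap F K).injective p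
  obtain ⟨𝒪, _⟩ := exists_valuationSubring_hasExtension (K := K) ν
  have : CharP 𝒪 p := 𝒪.subtype.charP Subtype.val_injective p
  choose ξ hξ using fun j => exists_pow_sub_self_eq hp (algebraMap F K (α j))
  choose η hη₀ hη using fun j => exists_pow_eq_algebraMap (K := K) (p := p) (h.ne_zero (Sum.inr j))
  have hξ𝒪 (j : ι) : 1 < 𝒪.valuation (ξ j) ∧
      𝒪.valuation (ξ j) ^ p = 𝒪.valuation (algebraMap F K (α j)) := by
    rw [← hξ j]
    refine one_lt_and_pow_eq_of_one_lt_pow_sub_self _ hp ?_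
    rw [hξ, ← not_le, Valuation.HasExtension.val_map_le_one_iff ν, not_le]
    exact hα j
  let R : SymbolRep p ι F K (⨂[F] j, SymbolAlgebraCharP p (α j) (β j)) :=
    CyclicRep.toSymbolRep fun j => CyclicRep.symbolAlgebraCharP p (hξ j) (hη j) (hη₀ j)
  have hR : R.IsTame ξ (1 : AddChar (ZMod p) (IsLocalRing.ResidueField 𝒪)) :=
    { ξ_ne_zero := fun j => (Valuation.ne_zero_iff _).1 (zero_lt_one.trans (hξ𝒪 j).1).ne'
      exists_g_eq := fun j i => by
        rw [← ZMod.natCast_zmod_val i, AddChar.one_apply]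
        exact exists_add_eq_mul (hξ𝒪 j).1 (by rw [map_natCast]; exact natCast_mem 𝒪 _)
      independent := h.dvd_of_valuation_pow_eq <| Sum.rec (fun j => (hξ𝒪 j).2)
        fun j => (map_pow _ _ _).symm.trans (congrArg _ (hη j)) }
  refine hR.rank_le_of_charCoeff_eq_zero (fun k hk hkp => ?_) (neg_ne_zero.2 one_ne_zero) (t := -1)
    (fun j a => ?_) (Or.inl rfl) V hV
  · have : CharP (IsLocalRing.ResidueField 𝒪) p :=
      CharP.of_ringHom_of_ne_zero (IsLocalRing.residue 𝒪) p (NeZero.ne p)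
    exact (CharP.cast_eq_zero_iff _ p k).not.2 (Nat.not_dvd_of_pos_of_lt hk hkp)
  · rw [map_neg, map_one]
    exact sum_add_castHom_pow (ξ j) a

end ValuedField

theorem mainTheorem2_general {F : Type u} [Field F] {Γ : Type*} [LinearOrderedCommGroupWithZero Γ]
    (ν : Valuation F Γ) {ι : Type*} [Fintype ι] {p : ℕ} (hp : p.Prime) {α β : ι → F}
    (h : HasIndependentValues ν p (Sum.elim α β)) :
    ((∀ k : ℕ, 0 < k → k < p → ν (k : F) = 1) → ∀ ρ : F, IsPrimitiveRoot ρ p →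
      ∀ V : Submodule F (⨂[F] j, SymbolAlgebra p ρ (α j) (β j)),
        (∀ v ∈ V, ∀ i ∈ Finset.Icc 1 (p - 1), charCoeff F i v = 0) →
          Module.rank F V ≤ (((p ^ (2 * Fintype.card ι) - 1) / (p - 1) : ℕ) : Cardinal)) ∧
    (CharP F p → (∀ j, 1 < ν (α j)) →
      ∀ V : Submodule F (⨂[F] j, SymbolAlgebraCharP p (α j) (β j)),
        (∀ v ∈ V, ∀ i ∈ Finset.Icc 1 (p - 1), charCoeff F i v = 0) →
          Module.rank F V ≤ (((p ^ (2 * Fintype.card ι) - 1) / (p - 1) : ℕ) : Cardinal)) :=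
  have : Fact p.Prime := ⟨hp⟩
  ⟨fun hcast _ hρ => rank_le_of_symbolAlgebra h hcast hρ,
    fun _ => rank_le_of_symbolAlgebraCharP h⟩

theorem mainTheorem2 {F₀ : Type u} [Field F₀] (p : ℕ) (hp : p.Prime)
    (hchar : ringChar F₀ = 0 ∨ p ≤ ringChar F₀) (m : ℕ) (F : SlotField F₀ m)
    (hF : F = SlotField.rational F₀ m ∨ F = SlotField.laurent F₀ m) :
    (ringChar F₀ ≠ p → ∀ ρ : F₀, IsPrimitiveRoot ρ p →
      ∀ V : Submodule F (⨂[F] j, SymbolAlgebra p (algebraMap F₀ F ρ) (F.α j) (F.β j)),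
        (∀ v ∈ V, ∀ i ∈ Finset.Icc 1 (p - 1), charCoeff F i v = 0) →
          Module.rank F V ≤ (((p ^ (2 * m) - 1) / (p - 1) : ℕ) : Cardinal)) ∧
    (ringChar F₀ = p →
      ∀ V : Submodule F (⨂[F] j, SymbolAlgebraCharP p (F.α j) (F.β j)),
        (∀ v ∈ V, ∀ i ∈ Finset.Icc 1 (p - 1), charCoeff F i v = 0) →
          Module.rank F V ≤ (((p ^ (2 * m) - 1) / (p - 1) : ℕ) : Cardinal)) := by
  obtain ⟨Γ, _, ν, h⟩ := SlotField.exists_isAdapted hF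
  have hrank := mainTheorem2_general ν hp (h.hasIndependentValues p)
  rw [Fintype.card_fin] at hrank
  refine ⟨fun _ ρ hρ => hrank.1 (fun k hk hkp => h.valuation_natCast ?_) _
    (hρ.map_of_injective (algebraMap F₀ F).injective), fun hcharp => hrank.2 ?_ h.one_lt_α⟩
  · exact natCast_ne_zero_of_lt_ringChar hchar hk hkp
  · have : CharP F₀ p := ringChar.of_eq hcharp
    exact charP_of_injective_algebraMap (algebraMap F₀ F).injective p
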